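/- Let $\alpha,\beta>-1$ with $a:=\frac{\alpha+\beta+1}{2}>0$, let $w(x)=(1-x)^\alpha(1+x)^\beta$ be the Jacobi weight on $[-1,1]$, and let $L_2([-1,1],w)$ be the real Hilbert space of measurable functions with $\int_{-1}^1 f(x)^2w(x)\,dx<\infty$. For $f\in L_2([-1,1],w)$ let $f_k$, $k\in\mathbb{N}_0$, be the Fourier coefficients of $f$ with respect to the orthonormal basis of normalized Jacobi polynomials. For $s>0$ let $K^s([-1,1],w)$ be the Hilbert space of all $f\in L_2([-1,1],w)$ with $\sum_{k=0}^\infty(1+a^{-1}k)^{2s}f_k^2<\infty$, equipped with the scalar product $\langle f,g\rangle_s=\sum_{k=0}^\infty(1+a^{-1}k)^{2s}f_kg_k$. For $d\in\mathbb{N}=\{1,2,\dots\}$ let $w_d(x)=\prod_{j=1}^d w(x_j)$ and let $K^s([-1,1]^d,w_d)$ be the $d$th Hilbert space tensor power of $K^s([-1,1],w)$, embedded into $L_2([-1,1]^d,w_d)$ by the $d$th tensor power of the embedding $K^s([-1,1],w)\hookrightarrow L_2([-1,1],w)$. Let $$a_n=\inf\{\|T-A\| : A \text{ bounded linear},\ \operatorname{rank}A<n\},\qquad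 n\in\mathbb{N},$$ be the approximation numbers of the embedding $T:K^s([-1,1]^d,w_d)\hookrightarrow L_2([-1,1]^d,w_d)$. For any such $\alpha,\beta$ and any $\delta\in(0,1]$, $s>0$, $d\in\mathbb{N}$ and $n\in\{2,\dots,2^d\}$, $$\left(\frac{a}{a+1}\right)^s\left(\frac1n\right)^{p}\le a_n\le\left(\frac{\exp\left(\frac{(2a)^{1+\delta}}{\delta}\right)}{n}\right)^{q},$$ $$p=\frac{s\log\frac{a+1}{a}}{\log\left(1+\frac{d}{\log_2 n}\right)},\qquad q=\frac{s\log\frac{a+1}{a}}{\log d+(1+\delta)\log\frac{a+1}{a}}.$$ The upper bound even holds for all $n\in\mathbb{N}$. -/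

import Mathlib

noncomputable section

open MeasureTheory
open scoped ENNReal

/-- The `n`th approximation number: the distance of `T`, in operator norm, to the bounded linear
operators of rank less than `n` (for `n ≥ 1`). -/
def approxNumber {E F : Type*} [NormedAddCommGroup E] [NormedSpace ℝ E]
    [NormedAddCommGroup F] [NormedSpace ℝ F] (T : E →L[ℝ] F) (n : ℕ) : ℝ :=
  ⨅ A : {A : E →L[ℝ] F // A.toLinearMap.rank < (n : Cardinal)}, ‖T - A.1‖

section TensorPower

variable {X : Type*} [NormedAddCommGroup X] [InnerProductSpace ℝ X] {d : ℕ}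

theorem gram_sum {ι E : Type*} [NormedAddCommGroup E] [InnerProductSpace ℝ E] (v : ι → E)
    (x y : ι →₀ ℝ) :
    inner ℝ (Finsupp.linearCombination ℝ v x) (Finsupp.linearCombination ℝ v y) =
      x.sum fun i a => y.sum fun j b => a * b * inner ℝ (v i) (v j) := by
  rw [Finsupp.linearCombination_apply, Finsupp.linearCombination_apply]
  simp only [Finsupp.sum, sum_inner, inner_sum, real_inner_smul_left, real_inner_smul_right,
    mul_assoc]
  rw [Finset.sum_comm]
  exact Finset.sum_congr rfl fun i _ => Finset.sum_congr rfl fun j _ => mul_left_comm _ _ _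

theorem posSemidef_iff_sum {ι : Type*} {M : Matrix ι ι ℝ} (h : M.PosSemidef) (x : ι →₀ ℝ) :
    0 ≤ x.sum fun i a => x.sum fun j b => a * b * M i j := by
  have := h.2 x
  simpa only [star_trivial, mul_right_comm] using this

theorem posSemidef_gram_sub {ι E F : Type*} [NormedAddCommGroup E] [InnerProductSpace ℝ E]
    [NormedAddCommGroup F] [InnerProductSpace ℝ F] (v : ι → E) (T : E →L[ℝ] F) :
    (Matrix.of fun i j =>
      ‖T‖ ^ 2 * inner ℝ (v i) (v j) - inner ℝ (T (v i)) (T (v j))).PosSemidef := by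
  refine ⟨?_, fun x => ?_⟩
  · ext i j
    simp [real_inner_comm]
  · have h1 := gram_sum v x x
    have h2 := gram_sum (fun i => T (v i)) x x
    have h3 : Finsupp.linearCombination ℝ (fun i => T (v i)) x =
        T (Finsupp.linearCombination ℝ v x) := by
      simp [Finsupp.linearCombination_apply, Finsupp.sum]
    rw [h3] at h2
    have h4 : ‖T (Finsupp.linearCombination ℝ v x)‖ ^ 2 ≤
        ‖T‖ ^ 2 * ‖Finsupp.linearCombination ℝ v x‖ ^ 2 := by
      rw [← mul_pow]
      gcongr
      exact T.le_opNorm _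
    rw [real_inner_self_eq_norm_sq] at h1 h2
    rw [h1, h2] at h4
    have h5 : (x.sum fun i xi => x.sum fun j xj => star xi * (Matrix.of fun i j =>
        ‖T‖ ^ 2 * inner ℝ (v i) (v j) - inner ℝ (T (v i)) (T (v j))) i j * xj) =
        ‖T‖ ^ 2 * (x.sum fun i a => x.sum fun j b => a * b * inner ℝ (v i) (v j)) -
        x.sum fun i a => x.sum fun j b => a * b * inner ℝ (T (v i)) (T (v j)) := by
      simp only [Finsupp.sum, Finset.mul_sum, ← Finset.sum_sub_distrib]
      refine Finset.sum_congr rfl fun i _ => Finset.sum_congr rfl fun j _ => ?_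
      simp only [star_trivial, Matrix.of_apply]
      ring
    rw [h5]
    linarith

theorem posSemidef_gram_of {ι E : Type*} [NormedAddCommGroup E] [InnerProductSpace ℝ E]
    (v : ι → E) : (Matrix.of fun i j => inner ℝ (v i) (v j)).PosSemidef := by
  have := posSemidef_gram_sub v (0 : E →L[ℝ] ℝ)
  refine ⟨?_, fun x => ?_⟩
  · ext i j
    simp [real_inner_comm]
  · have h1 := gram_sum v x x
    simp only [star_trivial, Matrix.of_apply, mul_right_comm]
    rw [← h1]
    exact real_inner_self_nonneg

theorem posSemidef_prod {ι κ E : Type*} [NormedAddCommGroup E] [InnerProductSpace ℝ E]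
    (s : Finset κ) (v : κ → ι → E) :
    (Matrix.of fun i j => ∏ k ∈ s, inner ℝ (v k i) (v k j)).PosSemidef := by
  classical
  induction s using Finset.induction_on with
  | empty =>
    have := posSemidef_gram_of (fun _ : ι => (1 : ℝ))
    simpa using this
  | insert k s hk ih =>
    have e : (Matrix.of fun i j => ∏ k ∈ insert k s, inner ℝ (v k i) (v k j)) =
        (Matrix.of fun i j => inner ℝ (v k i) (v k j)).hadamard
          (Matrix.of fun i j => ∏ k ∈ s, inner ℝ (v k i) (v k j)) := by
      ext i j
      simp [Finset.prod_insert hk]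
    rw [e]
    exact (posSemidef_gram_of (v k)).hadamard ih

theorem posSemidef_prod_sub {ι κ E F : Type*} [NormedAddCommGroup E] [InnerProductSpace ℝ E]
    [NormedAddCommGroup F] [InnerProductSpace ℝ F] (T : E →L[ℝ] F)
    (s : Finset κ) (v : κ → ι → E) :
    (Matrix.of fun i j => (‖T‖ ^ 2) ^ s.card * ∏ k ∈ s, inner ℝ (v k i) (v k j) -
      ∏ k ∈ s, inner ℝ (T (v k i)) (T (v k j))).PosSemidef := by
  classical
  induction s using Finset.induction_on with
  | empty =>
    have := Matrix.PosSemidef.zero (n := ι) (R := ℝ)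
    convert this using 1
    ext i j
    simp
  | insert k s hk ih =>
    have hc : 0 ≤ (‖T‖ ^ 2) ^ s.card := by positivity
    have h1 := ((posSemidef_gram_sub (v k) T).hadamard (posSemidef_prod s v)).smul hc
    have h2 := (posSemidef_gram_of (fun i => T (v k i))).hadamard ih
    have e : (Matrix.of fun i j => (‖T‖ ^ 2) ^ (insert k s).card *
        ∏ k ∈ insert k s, inner ℝ (v k i) (v k j) -
          ∏ k ∈ insert k s, inner ℝ (T (v k i)) (T (v k j))) =
        (‖T‖ ^ 2) ^ s.card • (Matrix.of fun i j =>
            ‖T‖ ^ 2 * inner ℝ (v k i) (v k j) - inner ℝ (T (v k i)) (T (v k j))).hadamard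
          (Matrix.of fun i j => ∏ k ∈ s, inner ℝ (v k i) (v k j)) +
        (Matrix.of fun i j => inner ℝ (T (v k i)) (T (v k j))).hadamard
          (Matrix.of fun i j => (‖T‖ ^ 2) ^ s.card * ∏ k ∈ s, inner ℝ (v k i) (v k j) -
            ∏ k ∈ s, inner ℝ (T (v k i)) (T (v k j))) := by
      ext i j
      simp [Finset.prod_insert hk, Finset.card_insert_of_notMem hk]
      ring
    rw [e]
    exact h1.add h2

variable (X d) in
/-- Finite formal linear combinations of elementary tensors `f₁ ⊗ ⋯ ⊗ f_d` with `f_j ∈ X`. -/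
abbrev PreHilbertPower : Type _ := (Fin d → X) →₀ ℝ

/-- The bilinear form with `⟨f₁ ⊗ ⋯ ⊗ f_d, g₁ ⊗ ⋯ ⊗ g_d⟩ = ∏ j, ⟨f_j, g_j⟩`. -/
def preInner (x y : PreHilbertPower X d) : ℝ :=
  x.sum fun f a => y.sum fun g b => a * b * ∏ j, inner ℝ (f j) (g j)

theorem preInner_comm (x y : PreHilbertPower X d) : preInner y x = preInner x y := by
  rw [preInner, preInner, Finsupp.sum_comm]
  refine Finsupp.sum_congr fun f _ => Finsupp.sum_congr fun g _ => ?_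
  simp only [real_inner_comm, mul_comm]

theorem preInner_add_left (x y z : PreHilbertPower X d) :
    preInner (x + y) z = preInner x z + preInner y z := by
  unfold preInner
  rw [Finsupp.sum_add_index']
  · simp
  · intro f a b
    rw [← Finsupp.sum_add]
    exact Finsupp.sum_congr fun g _ => by ring

theorem preInner_smul_left (x y : PreHilbertPower X d) (r : ℝ) :
    preInner (r • x) y = r * preInner x y := by
  unfold preInner
  rw [Finsupp.sum_smul_index (by simp), Finsupp.mul_sum]
  refine Finsupp.sum_congr fun f _ => ?_
  rw [Finsupp.mul_sum]
  exact Finsupp.sum_congr fun g _ => by ring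

instance PreHilbertPower.core : PreInnerProductSpace.Core ℝ (PreHilbertPower X d) where
  inner := preInner
  conj_inner_symm x y := preInner_comm x y
  add_left x y z := preInner_add_left x y z
  smul_left x y r := preInner_smul_left x y r
  re_inner_nonneg x := posSemidef_iff_sum
    (posSemidef_prod Finset.univ fun (j : Fin d) (f : Fin d → X) => f j) x

instance : SeminormedAddCommGroup (PreHilbertPower X d) :=
  InnerProductSpace.Core.toSeminormedAddCommGroup (𝕜 := ℝ)

instance : InnerProductSpace ℝ (PreHilbertPower X d) := .ofCore _

variable (X d) in
/-- The `d`th Hilbert space tensor power of `X`: the completion of the span of the elementary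
tensors with respect to the product inner product. -/
abbrev HilbertPower : Type _ := UniformSpace.Completion (PreHilbertPower X d)

/-- The elementary tensor `f₁ ⊗ ⋯ ⊗ f_d`. -/
def elemTensor (f : Fin d → X) : HilbertPower X d :=
  UniformSpace.Completion.coe' (Finsupp.single f 1 : PreHilbertPower X d)

theorem inner_preTensorPower (x y : PreHilbertPower X d) :
    inner ℝ x y = Finsupp.sum x fun f a => Finsupp.sum y fun g b =>
      a * b * ∏ j, inner ℝ (f j) (g j) := rfl

theorem inner_elemTensor (f g : Fin d → X) :
    inner ℝ (elemTensor f) (elemTensor g) = ∏ j, inner ℝ (f j) (g j) := by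
  rw [elemTensor, elemTensor, UniformSpace.Completion.inner_coe, inner_preTensorPower,
    Finsupp.sum_single_index, Finsupp.sum_single_index] <;> simp

theorem dense_span_elemTensor :
    Dense (Submodule.span ℝ (Set.range (elemTensor (X := X) (d := d))) :
      Set (HilbertPower X d)) := by
  refine UniformSpace.Completion.denseRange_coe.mono ?_
  rintro _ ⟨x, rfl⟩
  have : (x : HilbertPower X d) = Finsupp.sum x fun f a => a • elemTensor f := by
    have h : x = Finsupp.sum x fun f a => a • (Finsupp.single f 1 : PreHilbertPower X d) := by
      have := (Finsupp.sum_single x).symm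
      refine this.trans (Finsupp.sum_congr fun f _ => ?_)
      exact (Finsupp.smul_single_one f (x f)).symm
    conv_lhs => rw [h]
    rw [Finsupp.sum, ← UniformSpace.Completion.coe_toComplL (𝕜 := ℝ), map_sum]
    refine Finset.sum_congr rfl fun f _ => ?_
    rw [map_smul]
    rfl
  rw [this]
  exact Submodule.sum_mem _ fun f _ => Submodule.smul_mem _ _ (Submodule.subset_span ⟨f, rfl⟩)

variable {Ω : Type*} [MeasurableSpace Ω] {μ : Measure Ω} [IsFiniteMeasure μ]

theorem memLp_prod (f : Fin d → Lp ℝ 2 μ) :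
    MemLp (fun x : Fin d → Ω => ∏ j, f j (x j)) 2 (Measure.pi fun _ => μ) := by
  have hm : AEStronglyMeasurable (fun x : Fin d → Ω => ∏ j, f j (x j))
      (Measure.pi fun _ => μ) := by
    refine Finset.aestronglyMeasurable_fun_prod _ fun j _ => ?_
    exact (Lp.aestronglyMeasurable (f j)).comp_quasiMeasurePreserving
      (Measure.quasiMeasurePreserving_eval _ j)
  rw [memLp_two_iff_integrable_sq hm]
  simp only [← Finset.prod_pow]
  exact Integrable.fintype_prod (f := fun j x => (f j x) ^ 2)
    fun j => (Lp.memLp (f j)).integrable_sq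

/-- The elementary tensor `(f₁ ⊗ ⋯ ⊗ f_d)(x) = f₁(x₁) ⋯ f_d(x_d)` of functions in `L₂(μ)`. -/
def prodLp (f : Fin d → Lp ℝ 2 μ) : Lp ℝ 2 (Measure.pi fun _ : Fin d => μ) :=
  (memLp_prod f).toLp _

theorem inner_prodLp (f g : Fin d → Lp ℝ 2 μ) :
    inner ℝ (prodLp f) (prodLp g) = ∏ j, inner ℝ (f j) (g j) := by
  simp only [L2.inner_def]
  rw [← integral_fintype_prod_eq_prod (fun j x => inner ℝ (f j x) (g j x))]
  refine integral_congr_ae ?_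
  filter_upwards [(memLp_prod f).coeFn_toLp, (memLp_prod g).coeFn_toLp] with x hf hg
  rw [prodLp, prodLp, hf, hg]
  simp [Finset.prod_mul_distrib]

/-- The action of the tensor power of `T` on the span of elementary tensors. -/
def preTensorPowerMap (T : X →L[ℝ] Lp ℝ 2 μ) (d : ℕ) :
    PreHilbertPower X d →ₗ[ℝ] Lp ℝ 2 (Measure.pi fun _ : Fin d => μ) :=
  Finsupp.linearCombination ℝ fun f : Fin d → X => prodLp fun j => T (f j)

theorem norm_preTensorPowerMap_le (T : X →L[ℝ] Lp ℝ 2 μ) (d : ℕ) (x : PreHilbertPower X d) :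
    ‖preTensorPowerMap T d x‖ ≤ ‖T‖ ^ d * ‖x‖ := by
  refine le_of_sq_le_sq ?_ (by positivity)
  rw [mul_pow, ← real_inner_self_eq_norm_sq, ← real_inner_self_eq_norm_sq, preTensorPowerMap,
    gram_sum, inner_preTensorPower]
  have := posSemidef_iff_sum
    (posSemidef_prod_sub T Finset.univ fun (j : Fin d) (f : Fin d → X) => f j) x
  simp only [inner_prodLp]
  have h5 : (Finsupp.sum x fun f a => Finsupp.sum x fun g b => a * b *
      (Matrix.of fun f g : Fin d → X => (‖T‖ ^ 2) ^ (Finset.univ : Finset (Fin d)).card *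
        ∏ k, inner ℝ (f k) (g k) - ∏ k, inner ℝ (T (f k)) (T (g k))) f g) =
      (‖T‖ ^ d) ^ 2 * (Finsupp.sum x fun f a => Finsupp.sum x fun g b => a * b *
        ∏ k, inner ℝ (f k) (g k)) -
      Finsupp.sum x fun f a => Finsupp.sum x fun g b => a * b *
        ∏ k, inner ℝ (T (f k)) (T (g k)) := by
    simp only [Finsupp.sum, Finset.mul_sum, ← Finset.sum_sub_distrib]
    refine Finset.sum_congr rfl fun i _ => Finset.sum_congr rfl fun j _ => ?_
    simp only [Matrix.of_apply, Finset.card_univ, Fintype.card_fin]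
    ring
  rw [h5] at this
  linarith

/-- The `d`th tensor power `T^d` of `T : X → L₂(μ)`, as an operator `X^d → L₂(μ ⊗ ⋯ ⊗ μ)`: the
bounded operator with `T^d (f₁ ⊗ ⋯ ⊗ f_d) = T f₁ ⊗ ⋯ ⊗ T f_d`. -/
def tensorPowerMap (T : X →L[ℝ] Lp ℝ 2 μ) (d : ℕ) :
    HilbertPower X d →L[ℝ] Lp ℝ 2 (Measure.pi fun _ : Fin d => μ) :=
  ((preTensorPowerMap T d).mkContinuous _ (norm_preTensorPowerMap_le T d)).extend
    UniformSpace.Completion.toComplL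

theorem tensorPowerMap_elemTensor (T : X →L[ℝ] Lp ℝ 2 μ) (f : Fin d → X) :
    tensorPowerMap T d (elemTensor f) = prodLp fun j => T (f j) := by
  have h := ContinuousLinearMap.extend_eq
    ((preTensorPowerMap T d).mkContinuous _ (norm_preTensorPowerMap_le T d))
    (e := (UniformSpace.Completion.toComplL : PreHilbertPower X d →L[ℝ] HilbertPower X d))
    UniformSpace.Completion.denseRange_coe
    (UniformSpace.Completion.isUniformInducing_coe _) (Finsupp.single f 1 : PreHilbertPower X d)
  refine h.trans ?_
  refine (Finsupp.linearCombination_single ℝ (1 : ℝ) f).trans ?_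
  simp


theorem continuous_elemTensor : Continuous (elemTensor (X := X) (d := d)) := by
  rw [continuous_iff_continuousAt]
  intro g
  rw [ContinuousAt, tendsto_iff_norm_sub_tendsto_zero]
  have h : ∀ f : Fin d → X, ‖elemTensor f - elemTensor g‖ =
      √(∏ j, inner ℝ (f j) (f j) - 2 * ∏ j, inner ℝ (f j) (g j) +
        ∏ j, inner ℝ (g j) (g j)) := fun f => by
    rw [← inner_elemTensor, ← inner_elemTensor, ← inner_elemTensor, real_inner_self_eq_norm_sq,
      real_inner_self_eq_norm_sq, ← norm_sub_sq_real, Real.sqrt_sq (norm_nonneg _)]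
  simp only [h]
  have hc : Continuous fun f : Fin d → X =>
      √(∏ j, inner ℝ (f j) (f j) - 2 * ∏ j, inner ℝ (f j) (g j) + ∏ j, inner ℝ (g j) (g j)) := by
    fun_prop
  have := hc.tendsto g
  convert this using 2
  rw [eq_comm, Real.sqrt_eq_zero']
  linarith

/-- If `T` is an embedding, so is `T^d`: the tensor power is a space of functions. -/
theorem tensorPowerMap_injective [CompleteSpace X] {T : X →L[ℝ] Lp ℝ 2 μ}
    (hT : Function.Injective T) : Function.Injective (tensorPowerMap T d) := by
  refine (injective_iff_map_eq_zero _).2 fun h hh => ?_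
  have hD : Dense (LinearMap.range T.adjoint.toLinearMap : Set X) := by
    rw [Submodule.dense_iff_topologicalClosure_eq_top, Submodule.topologicalClosure_eq_top_iff,
      eq_bot_iff]
    intro x hx
    have h0 := (Submodule.mem_orthogonal _ _).1 hx (T.adjoint (T x)) ⟨T x, rfl⟩
    rw [ContinuousLinearMap.adjoint_inner_left, inner_self_eq_zero] at h0
    exact hT (h0.trans (map_zero T).symm)
  have h1 : ∀ y : Fin d → Lp ℝ 2 μ, inner ℝ h (elemTensor fun j => T.adjoint (y j)) = 0 := by
    intro y
    have key : ∀ x : HilbertPower X d, inner ℝ x (elemTensor fun j => T.adjoint (y j)) =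
        inner ℝ (tensorPowerMap T d x) (prodLp y) := by
      intro x
      have hcl : IsClosed {x : HilbertPower X d | inner ℝ x (elemTensor fun j => T.adjoint (y j)) =
        inner ℝ (tensorPowerMap T d x) (prodLp y)} := isClosed_eq (by fun_prop) (by fun_prop)
      have := dense_span_elemTensor (X := X) (d := d)
      refine hcl.closure_subset_iff.2 (fun z hz => ?_) (this x)
      refine Submodule.span_induction ?_ ?_ ?_ ?_ hz
      · rintro _ ⟨f, rfl⟩
        simp only [Set.mem_ofPred_eq]
        rw [inner_elemTensor, tensorPowerMap_elemTensor, inner_prodLp]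
        exact Finset.prod_congr rfl fun j _ => ContinuousLinearMap.adjoint_inner_right _ _ _
      · simp
      · intro a b _ _ ha hb
        simp only [Set.mem_ofPred_eq] at ha hb ⊢
        rw [map_add, inner_add_left, inner_add_left, ha, hb]
      · intro r a _ ha
        simp only [Set.mem_ofPred_eq] at ha ⊢
        rw [map_smul, real_inner_smul_left, real_inner_smul_left, ha]
    rw [key, hh, inner_zero_left]
  have h2 : ∀ f : Fin d → X, inner ℝ h (elemTensor f) = 0 := by
    have hd : Dense (Set.univ.pi fun _ : Fin d => (LinearMap.range T.adjoint.toLinearMap : Set X)) :=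
      dense_pi _ fun _ _ => hD
    have hcl : IsClosed {f : Fin d → X | inner ℝ h (elemTensor f) = 0} :=
      isClosed_eq (continuous_const.inner continuous_elemTensor) continuous_const
    intro f
    refine hcl.closure_subset_iff.2 (fun g hg => ?_) (hd f)
    choose y hy using fun j => hg j (Set.mem_univ j)
    have : g = fun j => T.adjoint (y j) := funext fun j => (hy j).symm
    rw [Set.mem_ofPred_eq, this]
    exact h1 y
  have h3 : ∀ x : HilbertPower X d, inner ℝ h x = 0 := by
    intro x
    have hcl : IsClosed {x : HilbertPower X d | inner ℝ h x = 0} :=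
      isClosed_eq (by fun_prop) continuous_const
    refine hcl.closure_subset_iff.2 (fun z hz => ?_) (dense_span_elemTensor (X := X) (d := d) x)
    refine Submodule.span_induction ?_ ?_ ?_ ?_ hz
    · rintro _ ⟨f, rfl⟩
      exact h2 f
    · simp
    · intro a b _ _ ha hb
      simp only [Set.mem_ofPred_eq] at ha hb ⊢
      rw [inner_add_right, ha, hb, add_zero]
    · intro r a _ ha
      simp only [Set.mem_ofPred_eq] at ha ⊢
      rw [real_inner_smul_right, ha, mul_zero]
  exact inner_self_eq_zero.1 (h3 h)

end TensorPower

section Jacobi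

open Polynomial

/-- Parameters: Jacobi exponents `α, β > -1` with `a = (α + β + 1) / 2 > 0`, smoothness `s > 0`. -/
structure JacobiData where
  α : ℝ
  β : ℝ
  s : ℝ
  neg_one_lt_α : -1 < α
  neg_one_lt_β : -1 < β
  a_pos_aux : 0 < (α + β + 1) / 2
  s_pos : 0 < s

namespace JacobiData

variable (J : JacobiData)

/-- The number `a = (α + β + 1) / 2`. -/
def a : ℝ := (J.α + J.β + 1) / 2

theorem a_pos : 0 < J.a := J.a_pos_aux

/-- The Jacobi weight `w(x) = (1 - x)^α (1 + x)^β`. -/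
def weight (x : ℝ) : ℝ := (1 - x) ^ J.α * (1 + x) ^ J.β

theorem measurable_weight : Measurable J.weight := by
  unfold weight
  fun_prop

theorem weight_nonneg {x : ℝ} (hx : x ∈ Set.Icc (-1 : ℝ) 1) : 0 ≤ J.weight x :=
  mul_nonneg (Real.rpow_nonneg (by linarith [hx.2]) _) (Real.rpow_nonneg (by linarith [hx.1]) _)

theorem intervalIntegrable_weight : IntervalIntegrable J.weight volume (-1) 1 := by
  have h1 : IntervalIntegrable J.weight volume (-1) 0 := by
    have h : IntervalIntegrable (fun x : ℝ => (1 + x) ^ J.β) volume (-1) 0 := by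
      have := (intervalIntegral.intervalIntegrable_rpow' (a := 0) (b := 1)
        J.neg_one_lt_β).comp_add_left 1
      simpa using this
    refine h.continuousOn_mul ?_
    refine ContinuousOn.rpow_const (by fun_prop) fun x hx => Or.inl ?_
    rw [Set.uIcc_of_le (by norm_num)] at hx
    linarith [hx.2]
  have h2 : IntervalIntegrable J.weight volume 0 1 := by
    have h : IntervalIntegrable (fun x : ℝ => (1 - x) ^ J.α) volume 0 1 := by
      have := (intervalIntegral.intervalIntegrable_rpow' (a := 1) (b := 0)
        J.neg_one_lt_α).comp_sub_left 1
      simpa using this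
    refine h.mul_continuousOn ?_
    refine ContinuousOn.rpow_const (by fun_prop) fun x hx => Or.inl ?_
    rw [Set.uIcc_of_le (by norm_num)] at hx
    linarith [hx.1]
  exact h1.trans h2

theorem integrableOn_weight : IntegrableOn J.weight (Set.Icc (-1) 1) volume :=
  (intervalIntegrable_iff_integrableOn_Icc_of_le (by norm_num)).1 J.intervalIntegrable_weight

/-- The measure `w(x) dx` on `[-1, 1]`. -/
def measure : Measure ℝ :=
  (volume.restrict (Set.Icc (-1) 1)).withDensity fun x => ENNReal.ofReal (J.weight x)

instance : IsFiniteMeasure J.measure :=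
  isFiniteMeasure_withDensity_ofReal J.integrableOn_weight.2

/-- The weighted space `Y = L₂([-1, 1], w)`. -/
abbrev L2 : Type := Lp ℝ 2 J.measure

theorem ae_mem_Icc : ∀ᵐ x ∂J.measure, x ∈ Set.Icc (-1 : ℝ) 1 :=
  (withDensity_absolutelyContinuous _ _).ae_le (ae_restrict_mem measurableSet_Icc)

theorem integral_measure (f : ℝ → ℝ) :
    ∫ x, f x ∂J.measure = ∫ x in (-1 : ℝ)..1, J.weight x * f x := by
  rw [measure, integral_withDensity_eq_integral_toReal_smul
    (J.measurable_weight.ennreal_ofReal) (by simp),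
    intervalIntegral.integral_of_le (by norm_num), ← integral_Icc_eq_integral_Ioc]
  refine setIntegral_congr_fun measurableSet_Icc fun x hx => ?_
  simp [ENNReal.toReal_ofReal (J.weight_nonneg hx)]

/-- Coefficients of the Jacobi polynomial `P_k` in powers of `(x - 1) / 2`. -/
def coef (k m : ℕ) : ℝ :=
  (ascPochhammer ℝ m).eval (k + 2 * J.a) * (ascPochhammer ℝ (k - m)).eval (J.α + m + 1) /
    (m.factorial * (k - m).factorial)

/-- The Jacobi polynomial
`P_k(x) = ∑_{m ≤ k} (k + α + β + 1)_m (α + m + 1)_{k - m} / (m! (k - m)!) ((x - 1) / 2)^m`. -/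
def jacobi (k : ℕ) : ℝ[X] :=
  ∑ m ∈ Finset.range (k + 1), C (J.coef k m) * (C (1 / 2) * (X - 1)) ^ m

theorem coef_succ {k m : ℕ} (h : m < k) :
    J.coef k (m + 1) * ((m + 1) * (m + 1 + J.α)) = J.coef k m * ((k - m) * (k + m + 2 * J.a)) := by
  obtain ⟨r, rfl⟩ : ∃ r, k = m + 1 + r := ⟨k - (m + 1), by omega⟩
  have e1 : m + 1 + r - (m + 1) = r := by omega
  have e2 : m + 1 + r - m = r + 1 := by omega
  unfold coef
  rw [e1, e2, ascPochhammer_succ_eval m, ascPochhammer_succ_left ℝ r]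
  simp only [eval_mul, eval_X, eval_comp, eval_add, eval_one, Nat.factorial_succ]
  have h1 : (m.factorial : ℝ) ≠ 0 := by positivity
  have h2 : (r.factorial : ℝ) ≠ 0 := by positivity
  have e3 : J.α + ((m + 1 : ℕ) : ℝ) + 1 = J.α + m + 1 + 1 := by push_cast; ring
  rw [e3]
  push_cast
  field_simp
  ring

/-- `P_k` as a polynomial in `t = (x - 1) / 2`. -/
def jacobiAux (k : ℕ) : ℝ[X] := ∑ m ∈ Finset.range (k + 1), C (J.coef k m) * X ^ m

theorem coeff_jacobiAux (k m : ℕ) :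
    (J.jacobiAux k).coeff m = if m ≤ k then J.coef k m else 0 := by
  simp [jacobiAux, coeff_C_mul, coeff_X_pow]

theorem jacobi_eq_comp (k : ℕ) : J.jacobi k = (J.jacobiAux k).comp (C (1 / 2) * (X - 1)) := by
  simp [jacobi, jacobiAux, Polynomial.sum_comp]

theorem jacobiAux_ode (k : ℕ) :
    (X ^ 2 + X) * derivative (derivative (J.jacobiAux k)) +
      (C (J.α + 1) + C (J.α + J.β + 2) * X) * derivative (J.jacobiAux k) -
      C (k * (k + 2 * J.a)) * J.jacobiAux k = 0 := by
  ext m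
  have key : (J.jacobiAux k).coeff (m + 1) * ((m + 1) * (m + 1 + J.α)) =
      (J.jacobiAux k).coeff m * ((k - m) * (k + m + 2 * J.a)) := by
    rw [coeff_jacobiAux, coeff_jacobiAux]
    rcases lt_trichotomy m k with h | h | h
    · rw [if_pos (by omega), if_pos h.le, J.coef_succ h]
    · subst h; simp
    · rw [if_neg (by omega), if_neg (by omega)]; simp
  have ha : 2 * J.a = J.α + J.β + 1 := by unfold a; ring
  rw [ha] at key ⊢
  have e : (X ^ 2 + X) * derivative (derivative (J.jacobiAux k)) +
      (C (J.α + 1) + C (J.α + J.β + 2) * X) * derivative (J.jacobiAux k) -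
      C (k * (k + (J.α + J.β + 1))) * J.jacobiAux k =
      X * (X * derivative (derivative (J.jacobiAux k))) +
      X * derivative (derivative (J.jacobiAux k)) +
      C (J.α + 1) * derivative (J.jacobiAux k) +
      C (J.α + J.β + 2) * (X * derivative (J.jacobiAux k)) -
      C (k * (k + (J.α + J.β + 1))) * J.jacobiAux k := by ring
  rw [e]
  simp only [coeff_add, coeff_sub, coeff_C_mul, coeff_zero]
  rcases m with _ | _ | m
  · simp [coeff_derivative] at key ⊢
    linear_combination key
  · simp [coeff_derivative] at key ⊢
    linear_combination key
  · simp [coeff_derivative] at key ⊢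
    linear_combination key

/-- The Jacobi differential equation `(1 - x²) P'' + (β - α - (α + β + 2) x) P' + k (k + 2 a) P = 0`,
i.e. `- w⁻¹ ((1 - x²) w P')' = k (k + 2 a) P`. -/
theorem jacobi_ode (k : ℕ) (x : ℝ) :
    (1 - x ^ 2) * (derivative (derivative (J.jacobi k))).eval x +
      (J.β - J.α - (J.α + J.β + 2) * x) * (derivative (J.jacobi k)).eval x +
      k * (k + 2 * J.a) * (J.jacobi k).eval x = 0 := by
  have h := congrArg (eval (1 / 2 * (x - 1))) (J.jacobiAux_ode k)
  rw [jacobi_eq_comp]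
  simp only [derivative_comp, eval_add, eval_sub, eval_mul, eval_pow, eval_X, eval_C, eval_zero,
    derivative_mul, derivative_C, derivative_sub, derivative_X, derivative_one, eval_comp,
    eval_one, zero_mul, zero_add, sub_zero, mul_one] at h ⊢
  linear_combination (-1) * h

theorem eval_one_jacobi (k : ℕ) :
    (J.jacobi k).eval 1 = (ascPochhammer ℝ k).eval (J.α + 1) / k.factorial := by
  rw [jacobi_eq_comp, eval_comp]
  simp [← coeff_zero_eq_eval_zero, coeff_jacobiAux, coef]

theorem degree_jacobi (k : ℕ) : (J.jacobi k).degree = k := by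
  have hc : J.coef k k ≠ 0 := by
    unfold coef
    have h := ascPochhammer_pos k ((k : ℝ) + 2 * J.a) (by have := J.a_pos; positivity)
    rw [Nat.sub_self, ascPochhammer_zero, eval_one, mul_one]
    exact div_ne_zero h.ne' (by positivity)
  have h1 : (J.jacobiAux k).natDegree = k := by
    refine natDegree_eq_of_le_of_coeff_ne_zero ?_ ?_
    · refine natDegree_le_iff_coeff_eq_zero.2 fun N hN => ?_
      rw [coeff_jacobiAux, if_neg (by omega)]
    · rw [coeff_jacobiAux, if_pos le_rfl]; exact hc
  have h2 : (C (1 / 2 : ℝ) * (X - 1)).natDegree = 1 := by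
    rw [natDegree_C_mul (by norm_num), ← C_1, natDegree_X_sub_C]
  have h3 : (J.jacobi k).natDegree = k := by rw [jacobi_eq_comp, natDegree_comp, h1, h2, mul_one]
  have h4 : J.jacobi k ≠ 0 := by
    rw [jacobi_eq_comp]
    intro h0
    rcases comp_eq_zero_iff.1 h0 with h | h
    · have := J.coeff_jacobiAux k k
      rw [h] at this
      simp at this
      exact hc this.symm
    · have := congrArg natDegree h.2
      rw [h2] at this
      simp at this
  rw [degree_eq_natDegree h4, h3]

/-- `P_k` is orthogonal to `P_l` with respect to the Jacobi weight. -/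
theorem integral_jacobi_mul_jacobi {k l : ℕ} (hkl : k ≠ l) :
    ∫ x in (-1 : ℝ)..1, J.weight x * ((J.jacobi k).eval x * (J.jacobi l).eval x) = 0 := by
  set P := J.jacobi k with hP
  set Q := J.jacobi l with hQ
  let W : ℝ[X] := derivative P * Q - P * derivative Q
  let F : ℝ → ℝ := fun x => (1 - x) ^ (J.α + 1) * (1 + x) ^ (J.β + 1) * W.eval x
  have hα := J.neg_one_lt_α
  have hβ := J.neg_one_lt_β
  have hF : ContinuousOn F (Set.Icc (-1) 1) := by
    refine ContinuousOn.mul (ContinuousOn.mul ?_ ?_) W.continuous.continuousOn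
    · exact ContinuousOn.rpow_const (by fun_prop) fun x _ => Or.inr (by linarith)
    · exact ContinuousOn.rpow_const (by fun_prop) fun x _ => Or.inr (by linarith)
  let c : ℝ := l * (l + 2 * J.a) - k * (k + 2 * J.a)
  have hd : ∀ x ∈ Set.Ioo (-1 : ℝ) 1,
      HasDerivAt F (c * (J.weight x * (P.eval x * Q.eval x))) x := by
    intro x hx
    have x1 : 0 < 1 - x := by linarith [hx.2]
    have x2 : 0 < 1 + x := by linarith [hx.1]
    have d1 : HasDerivAt (fun y : ℝ => (1 - y) ^ (J.α + 1)) (-1 * (J.α + 1) * (1 - x) ^ J.α) x := by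
      have := ((hasDerivAt_id x).const_sub 1).rpow_const (p := J.α + 1) (Or.inl x1.ne')
      simpa using this
    have d2 : HasDerivAt (fun y : ℝ => (1 + y) ^ (J.β + 1)) (1 * (J.β + 1) * (1 + x) ^ J.β) x := by
      have := ((hasDerivAt_id x).const_add 1).rpow_const (p := J.β + 1) (Or.inl x2.ne')
      simpa using this
    have d3 := (d1.mul d2).mul (W.hasDerivAt x)
    refine d3.congr_deriv ?_
    have oP := J.jacobi_ode k x
    have oQ := J.jacobi_ode l x
    rw [← hP] at oP
    rw [← hQ] at oQ
    simp only [W, derivative_sub, derivative_mul, eval_sub, eval_mul, eval_add, c, weight]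
    rw [Pi.mul_apply, Real.rpow_add_one x1.ne', Real.rpow_add_one x2.ne']
    linear_combination ((1 - x) ^ J.α * (1 + x) ^ J.β) * (Q.eval x * oP - P.eval x * oQ)
  have hint : IntervalIntegrable (fun x => c * (J.weight x * (P.eval x * Q.eval x)))
      volume (-1) 1 := by
    refine (J.intervalIntegrable_weight.mul_continuousOn ?_).const_mul c
    exact (P.continuous.mul Q.continuous).continuousOn
  have h := intervalIntegral.integral_eq_sub_of_hasDerivAt_of_le (by norm_num) hF hd hint
  have h0 : F 1 - F (-1) = 0 := by
    simp only [F]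
    rw [show (1 : ℝ) - 1 = 0 by norm_num, show (1 : ℝ) + -1 = 0 by norm_num,
      Real.zero_rpow (by linarith), Real.zero_rpow (by linarith)]
    simp
  rw [h0, intervalIntegral.integral_const_mul] at h
  rcases mul_eq_zero.1 h with h | h
  · exfalso
    have ha := J.a_pos
    have : ((l : ℝ) - k) * (l + k + 2 * J.a) = 0 := by linear_combination h
    rcases mul_eq_zero.1 this with h | h
    · exact hkl (by exact_mod_cast (sub_eq_zero.1 h).symm)
    · have : (0 : ℝ) < l + k + 2 * J.a := by positivity
      linarith
  · exact h

theorem memLp_poly (q : ℝ[X]) : MemLp (fun x => q.eval x) 2 J.measure := by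
  obtain ⟨M, hM⟩ := (isCompact_Icc (a := (-1 : ℝ)) (b := 1)).exists_bound_of_continuousOn
    q.continuous.continuousOn
  exact MemLp.of_bound q.continuous.aestronglyMeasurable M
    (J.ae_mem_Icc.mono fun x hx => hM x hx)

/-- A polynomial, as an element of `L₂([-1, 1], w)`. -/
def polyLp : ℝ[X] →ₗ[ℝ] J.L2 where
  toFun q := (J.memLp_poly q).toLp _
  map_add' p q := by
    rw [← MemLp.toLp_add]
    exact MemLp.toLp_congr _ _ (Filter.Eventually.of_forall fun x => by simp)
  map_smul' r q := by
    rw [RingHom.id_apply, ← MemLp.toLp_const_smul]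
    exact MemLp.toLp_congr _ _ (Filter.Eventually.of_forall fun x => by simp)

theorem coeFn_polyLp (q : ℝ[X]) : J.polyLp q =ᵐ[J.measure] fun x => q.eval x :=
  (J.memLp_poly q).coeFn_toLp

theorem inner_polyLp (p q : ℝ[X]) :
    inner ℝ (J.polyLp p) (J.polyLp q) =
      ∫ x in (-1 : ℝ)..1, J.weight x * (p.eval x * q.eval x) := by
  rw [L2.inner_def, ← integral_measure]
  refine integral_congr_ae ?_
  filter_upwards [J.coeFn_polyLp p, J.coeFn_polyLp q] with x hp hq
  rw [hp, hq]
  simp [mul_comm]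

theorem polyLp_ne_zero {q : ℝ[X]} (hq : q ≠ 0) : J.polyLp q ≠ 0 := by
  intro h
  have h1 : ∀ᵐ x ∂J.measure, q.eval x = 0 := by
    have := J.coeFn_polyLp q
    rw [h] at this
    filter_upwards [this, Lp.coeFn_zero ℝ 2 J.measure] with x hx h0
    rw [← hx, h0]
    rfl
  rw [measure, ae_withDensity_iff J.measurable_weight.ennreal_ofReal,
    ae_restrict_iff' measurableSet_Icc] at h1
  have h2 : ∀ᵐ x : ℝ, x ∉ (q.roots.toFinset : Set ℝ) :=
    (q.roots.toFinset.finite_toSet.countable.ae_notMem volume)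
  have h3 : ∀ᵐ x : ℝ, x ∉ Set.Ioo (-1 : ℝ) 1 := by
    filter_upwards [h1, h2] with x hx hr hI
    have hw : 0 < J.weight x :=
      mul_pos (Real.rpow_pos_of_pos (by linarith [hI.2]) _)
        (Real.rpow_pos_of_pos (by linarith [hI.1]) _)
    have := hx ⟨hI.1.le, hI.2.le⟩ (by simpa using hw)
    exact hr (by simp [hq, this])
  rw [ae_iff] at h3
  simp only [not_not, Set.ofPred_mem_eq, Real.volume_Ioo] at h3
  norm_num at h3

theorem denseRange_polyLp : DenseRange J.polyLp := by
  have h := BoundedContinuousFunction.toLp_denseRange (E := ℝ) J.measure ℝ (p := 2) (by simp)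
  refine dense_iff_closure_eq.2 (Set.eq_univ_of_univ_subset ?_)
  rw [← h.closure_range]
  refine closure_minimal ?_ isClosed_closure
  rintro _ ⟨g, rfl⟩
  rw [Metric.mem_closure_iff]
  intro ε hε
  set K : ℝ := (measureUnivNNReal J.measure : ℝ) ^ (2 : ℝ≥0∞).toReal⁻¹ with hK
  have hK0 : 0 ≤ K := Real.rpow_nonneg (NNReal.coe_nonneg _) _
  obtain ⟨q, hq⟩ := exists_polynomial_near_of_continuousOn (-1) 1 g g.continuous.continuousOn
    (ε / (K + 1)) (by positivity)
  refine ⟨J.polyLp q, ⟨q, rfl⟩, ?_⟩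
  rw [dist_comm, dist_eq_norm]
  have hb : ‖J.polyLp q - BoundedContinuousFunction.toLp 2 J.measure ℝ g‖ ≤
      K * (ε / (K + 1)) := by
    have := Lp.norm_le_of_ae_bound (p := 2) (μ := J.measure)
      (f := J.polyLp q - BoundedContinuousFunction.toLp 2 J.measure ℝ g) (C := ε / (K + 1))
      (by positivity) (by
        filter_upwards [Lp.coeFn_sub (J.polyLp q)
          (BoundedContinuousFunction.toLp 2 J.measure ℝ g), J.coeFn_polyLp q,
          BoundedContinuousFunction.coeFn_toLp (p := 2) (μ := J.measure) ℝ g, J.ae_mem_Icc]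
          with x h1 h2 h3 h4
        rw [h1, Pi.sub_apply, h2, h3]
        exact (hq x h4).le)
    simpa [hK] using this
  refine hb.trans_lt ?_
  rw [mul_div_assoc', div_lt_iff₀ (by positivity)]
  nlinarith

/-- The normalized Jacobi polynomials in `L₂([-1, 1], w)`. -/
def jacobiLp (k : ℕ) : J.L2 := ‖J.polyLp (J.jacobi k)‖⁻¹ • J.polyLp (J.jacobi k)

theorem polyLp_jacobi_ne_zero (k : ℕ) : J.polyLp (J.jacobi k) ≠ 0 :=
  J.polyLp_ne_zero fun h => by simpa [h] using J.degree_jacobi k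

theorem orthonormal_jacobiLp : Orthonormal ℝ J.jacobiLp := by
  refine ⟨fun k => ?_, fun k l hkl => ?_⟩
  · rw [jacobiLp, norm_smul, norm_inv, norm_norm,
      inv_mul_cancel₀ (norm_ne_zero_iff.2 (J.polyLp_jacobi_ne_zero k))]
  · simp only [jacobiLp, real_inner_smul_left, real_inner_smul_right, inner_polyLp,
      J.integral_jacobi_mul_jacobi hkl, mul_zero]

theorem span_jacobiLp : ⊤ ≤ (Submodule.span ℝ (Set.range J.jacobiLp)).topologicalClosure := by
  have h : LinearMap.range J.polyLp ≤ Submodule.span ℝ (Set.range J.jacobiLp) := by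
    let S : Polynomial.Sequence ℝ := ⟨J.jacobi, J.degree_jacobi⟩
    have hS := S.span fun i => (leadingCoeff_ne_zero.2 (S.ne_zero i)).isUnit
    rw [LinearMap.range_eq_map, ← hS, Submodule.map_span_le]
    rintro _ ⟨k, rfl⟩
    have : J.polyLp (S k) = ‖J.polyLp (J.jacobi k)‖ • J.jacobiLp k := by
      rw [jacobiLp, smul_smul, mul_inv_cancel₀ (norm_ne_zero_iff.2 (J.polyLp_jacobi_ne_zero k)),
        one_smul]
    rw [this]
    exact Submodule.smul_mem _ _ (Submodule.subset_span ⟨k, rfl⟩)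
  intro f _
  exact closure_mono (by exact h) (J.denseRange_polyLp f)

/-- The orthonormal basis of `L₂([-1, 1], w)` of normalized Jacobi polynomials. -/
def jacobiBasis : HilbertBasis ℕ ℝ J.L2 := HilbertBasis.mk J.orthonormal_jacobiLp J.span_jacobiLp

/-- The `k`th Fourier coefficient `f_k` of `f` with respect to the normalized Jacobi basis. -/
def fourierCoef (k : ℕ) : J.L2 →ₗ[ℝ] ℝ := (innerSL ℝ (J.jacobiLp k)).toLinearMap

theorem hasSum_fourierCoef_sq (f : J.L2) :
    HasSum (fun k => J.fourierCoef k f ^ 2) (‖f‖ ^ 2) := by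
  have := J.jacobiBasis.hasSum_inner_mul_inner f f
  rw [real_inner_self_eq_norm_sq] at this
  have e : (fun k => J.fourierCoef k f ^ 2) =
      fun k => inner ℝ f (J.jacobiBasis k) * inner ℝ (J.jacobiBasis k) f := by
    funext k
    rw [real_inner_comm, ← sq, jacobiBasis, HilbertBasis.coe_mk]
    rfl
  rw [e]
  exact this

/-- The Fourier weights `(1 + k / a)^(2 s)`. -/
def fourierWeight (k : ℕ) : ℝ := (1 + J.a⁻¹ * k) ^ (2 * J.s)

theorem one_le_fourierWeight (k : ℕ) : 1 ≤ J.fourierWeight k := by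
  have h1 := J.a_pos
  have h2 := J.s_pos
  refine Real.one_le_rpow ?_ (by positivity)
  have : 0 ≤ J.a⁻¹ * k := by positivity
  linarith

theorem summable_mul {f g : J.L2}
    (hf : Summable fun k => J.fourierWeight k * J.fourierCoef k f ^ 2)
    (hg : Summable fun k => J.fourierWeight k * J.fourierCoef k g ^ 2) :
    Summable fun k => J.fourierWeight k * (J.fourierCoef k f * J.fourierCoef k g) := by
  refine Summable.of_norm_bounded (hf.add hg) fun k => ?_
  have h := J.one_le_fourierWeight k
  rw [Real.norm_eq_abs, abs_mul, abs_of_nonneg (by linarith : 0 ≤ J.fourierWeight k), ← mul_add,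
    abs_mul]
  refine mul_le_mul_of_nonneg_left ?_ (by linarith)
  rw [← sq_abs (J.fourierCoef k f), ← sq_abs (J.fourierCoef k g)]
  nlinarith [sq_nonneg (|J.fourierCoef k f| - |J.fourierCoef k g|),
    abs_nonneg (J.fourierCoef k f), abs_nonneg (J.fourierCoef k g)]

/-- The functions `f ∈ L₂([-1, 1], w)` with `∑ (1 + k / a)^(2 s) f_k² < ∞`. -/
def smoothSubmodule : Submodule ℝ J.L2 where
  carrier := {f | Summable fun k => J.fourierWeight k * J.fourierCoef k f ^ 2}
  zero_mem' := by simp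
  add_mem' {f g} hf hg := by
    refine ((hf.add hg).add ((J.summable_mul hf hg).mul_left 2)).congr fun k => ?_
    rw [map_add]
    ring
  smul_mem' r f hf := by
    refine (hf.mul_left (r ^ 2)).congr fun k => ?_
    rw [map_smul, smul_eq_mul]
    ring

/-- The space `X = K^s([-1, 1], w)` (a type of its own, since its norm is not the one of `L₂`). -/
def K : Type := J.smoothSubmodule

instance : AddCommGroup J.K := inferInstanceAs (AddCommGroup J.smoothSubmodule)

instance : Module ℝ J.K := inferInstanceAs (Module ℝ J.smoothSubmodule)

/-- The inclusion of `K^s([-1, 1], w)` into `L₂([-1, 1], w)`, as a linear map. -/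
def incl : J.K →ₗ[ℝ] J.L2 := J.smoothSubmodule.subtype

theorem summable_incl (f : J.K) :
    Summable fun k => J.fourierWeight k * J.fourierCoef k (J.incl f) ^ 2 := f.2

/-- The scalar product `⟨f, g⟩_s = ∑ (1 + k / a)^(2 s) f_k g_k`. -/
instance K.core : InnerProductSpace.Core ℝ J.K where
  inner f g := ∑' k, J.fourierWeight k * (J.fourierCoef k (J.incl f) * J.fourierCoef k (J.incl g))
  conj_inner_symm f g := by simp only [RCLike.conj_to_real, mul_comm]
  add_left f g h := by
    rw [← (J.summable_mul (J.summable_incl f) (J.summable_incl h)).tsum_add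
      (J.summable_mul (J.summable_incl g) (J.summable_incl h))]
    refine tsum_congr fun k => ?_
    rw [map_add, map_add]
    ring
  smul_left f g r := by
    rw [RCLike.conj_to_real, ← tsum_mul_left]
    refine tsum_congr fun k => ?_
    rw [map_smul, map_smul, smul_eq_mul]
    ring
  re_inner_nonneg f := by
    refine tsum_nonneg fun k => ?_
    have := J.one_le_fourierWeight k
    exact mul_nonneg (by linarith) (mul_self_nonneg _)
  definite f hf := by
    have h0 : ∀ k, 0 ≤ J.fourierWeight k *
        (J.fourierCoef k (J.incl f) * J.fourierCoef k (J.incl f)) := fun k =>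
      mul_nonneg (by linarith [J.one_le_fourierWeight k]) (mul_self_nonneg _)
    have h1 := ((J.summable_mul (J.summable_incl f) (J.summable_incl f)).hasSum_iff.2 hf)
    have h2 := (hasSum_zero_iff_of_nonneg h0).1 h1
    have h3 := J.hasSum_fourierCoef_sq (J.incl f)
    have h4 : ∀ k, J.fourierCoef k (J.incl f) ^ 2 = 0 := fun k => by
      have := congrFun h2 k
      have hw := J.one_le_fourierWeight k
      rcases mul_eq_zero.1 this with h | h
      · linarith
      · rw [sq, h]
    simp only [h4] at h3
    have h5 := h3.unique hasSum_zero
    have h6 : J.incl f = 0 := by simpa using h5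
    exact Subtype.ext h6

instance : NormedAddCommGroup J.K := InnerProductSpace.Core.toNormedAddCommGroup (𝕜 := ℝ)

instance : InnerProductSpace ℝ J.K := .ofCore _

theorem inner_K (f g : J.K) : inner ℝ f g =
    ∑' k, J.fourierWeight k * (J.fourierCoef k (J.incl f) * J.fourierCoef k (J.incl g)) := rfl

theorem norm_incl_le (f : J.K) : ‖J.incl f‖ ≤ 1 * ‖f‖ := by
  rw [one_mul]
  refine le_of_sq_le_sq ?_ (norm_nonneg _)
  rw [← real_inner_self_eq_norm_sq f, inner_K]
  refine hasSum_le (fun k => ?_) (J.hasSum_fourierCoef_sq (J.incl f))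
    (J.summable_mul (J.summable_incl f) (J.summable_incl f)).hasSum
  have := J.one_le_fourierWeight k
  nlinarith [sq_nonneg (J.fourierCoef k (J.incl f))]

/-- The embedding `T` of `K^s([-1, 1], w)` into `L₂([-1, 1], w)`. -/
def embedding : J.K →L[ℝ] J.L2 := J.incl.mkContinuous 1 J.norm_incl_le

theorem embedding_injective : Function.Injective J.embedding := fun _ _ h => Subtype.ext h

/-- `K^s([-1, 1], w)` is complete. -/
instance : CompleteSpace J.K := by
  have hw : ∀ k, 0 < J.fourierWeight k := fun k => by linarith [J.one_le_fourierWeight k]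
  let U : J.K →ₗ[ℝ] lp (fun _ : ℕ => ℝ) 2 :=
    { toFun := fun f => ⟨fun k => √(J.fourierWeight k) * J.fourierCoef k (J.incl f), by
        refine memℓp_gen ((J.summable_incl f).congr fun k => ?_)
        simp [mul_pow, Real.sq_sqrt (hw k).le]⟩
      map_add' := fun f g => by
        ext k
        change √(J.fourierWeight k) * J.fourierCoef k (J.incl (f + g)) =
          √(J.fourierWeight k) * J.fourierCoef k (J.incl f) +
            √(J.fourierWeight k) * J.fourierCoef k (J.incl g)
        rw [map_add, map_add, mul_add]
      map_smul' := fun r f => by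
        ext k
        simp [mul_left_comm] }
  have hU : ∀ f, ‖U f‖ = ‖f‖ := fun f => by
    refine (sq_eq_sq₀ (norm_nonneg _) (norm_nonneg _)).1 ?_
    rw [← real_inner_self_eq_norm_sq f, ← real_inner_self_eq_norm_sq (U f), lp.inner_eq_tsum,
      inner_K]
    refine tsum_congr fun k => ?_
    change inner ℝ (√(J.fourierWeight k) * J.fourierCoef k (J.incl f))
      (√(J.fourierWeight k) * J.fourierCoef k (J.incl f)) = _
    rw [real_inner_self_eq_norm_sq, Real.norm_eq_abs, sq_abs, mul_pow, Real.sq_sqrt (hw k).le, sq]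
  let V : J.K →ₗᵢ[ℝ] lp (fun _ : ℕ => ℝ) 2 := ⟨U, hU⟩
  have hV : Function.Surjective V := by
    intro c
    have hc : Summable fun k => c k ^ 2 := by
      have := (lp.memℓp c).summable (by simp)
      simpa using this
    have hm : Memℓp (fun k => (√(J.fourierWeight k))⁻¹ * c k) 2 := by
      refine memℓp_gen (Summable.of_nonneg_of_le (fun k => by positivity) (fun k => ?_) hc)
      have h1 : (√(J.fourierWeight k))⁻¹ ^ 2 ≤ 1 := by
        rw [inv_pow, Real.sq_sqrt (hw k).le]
        exact inv_le_one_of_one_le₀ (J.one_le_fourierWeight k)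
      simp only [ENNReal.toReal_ofNat, Real.rpow_two, Real.norm_eq_abs, sq_abs, mul_pow]
      nlinarith [sq_nonneg (c k)]
    let g : J.L2 := J.jacobiBasis.repr.symm ⟨_, hm⟩
    have hg : ∀ k, J.fourierCoef k g = (√(J.fourierWeight k))⁻¹ * c k := fun k => by
      have h := J.jacobiBasis.repr_apply_apply g k
      rw [LinearIsometryEquiv.apply_symm_apply, jacobiBasis, HilbertBasis.coe_mk] at h
      exact h.symm
    have hs : ∀ k, √(J.fourierWeight k) ≠ 0 := fun k => (Real.sqrt_pos.2 (hw k)).ne'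
    have hgm : g ∈ J.smoothSubmodule := by
      refine hc.congr fun k => ?_
      rw [hg, mul_pow, inv_pow, Real.sq_sqrt (hw k).le, mul_inv_cancel_left₀ (hw k).ne']
    refine ⟨⟨g, hgm⟩, ?_⟩
    ext k
    change √(J.fourierWeight k) * J.fourierCoef k g = c k
    rw [hg, mul_inv_cancel_left₀ (hs k)]
  have hc := (LinearIsometryEquiv.ofSurjective V hV).toIsometryEquiv.completeSpace
  exact hc

/-- The embedding `T^d` of the space `X^d = K^s([-1, 1]^d, w_d)` of Jacobi functions of mixed order
`s` into `L₂([-1, 1]^d, w_d)`, where `w_d(x) dx` is the `d`-fold product of the measure `w(x) dx`. -/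
def mixedEmbedding (d : ℕ) :
    HilbertPower J.K d →L[ℝ] Lp ℝ 2 (Measure.pi fun _ : Fin d => J.measure) :=
  tensorPowerMap J.embedding d

theorem mixedEmbedding_injective (d : ℕ) : Function.Injective (J.mixedEmbedding d) :=
  tensorPowerMap_injective J.embedding_injective

end JacobiData
end Jacobi

end

/-! The embedding is diagonal. Rescaled to unit vectors of $K^s$, the Jacobi polynomials form a
Hilbert basis that the one-dimensional embedding sends to orthogonal vectors of length
$\sigma_k=(1+k/a)^{-s}$. Products of these basis vectors form a Hilbert basis of the tensor power,
and its embedding sends them to orthogonal vectors of length $\prod_j\sigma_{\kappa_j}$,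
$\kappa\in\mathbb{N}_0^d$. Bounding $a_n$ thus becomes counting large products: $a_n\le t$ if fewer
than $n$ of them exceed $t$ (`approxNumber_le_of_orthogonal`), and $a_n\ge t$ if at least $n$ of
them are $\ge t$ (`le_approxNumber_of_orthogonal`).

Lower bound: only $\kappa\in\{0,1\}^d$ are used. Those with at most $m$ ones have product
$\ge\sigma_1^m$, and there are $\sum_{i\le m}\binom di$ of them. For the least $m=l+1$ where this
count reaches $n$, we have $(1+d/l)^l\le\sum_{i\le l}\binom di<n$ if $l\ge1$. Hence $l\le\log_2 n$,
and then $l\log(1+d/\log_2 n)\le\log n$. The extra factor $\sigma_1$ is the constant in front.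

Upper bound: Markov's inequality for the $1/q$-th powers of the products. With
$L=\log\frac{a+1}{a}$, $\sigma_k^{1/q}=(1+k/a)^{-\log d/L-(1+\delta)}$. For $k\ge1$ the first part
of the exponent contributes at most $1/d$ and the second at most $(a/k)^{1+\delta}$, so
$\sum_k\sigma_k^{1/q}\le1+c/d$ with $c=(2a)^{1+\delta}/\delta$. The sum over all $\kappa$ is then at
most $(1+c/d)^d\le e^c$, uniformly in $d$. -/

noncomputable section

open MeasureTheory

/-! ### Approximation numbers of diagonal operators -/

section DiagonalOperator

variable {ι E F : Type*} [NormedAddCommGroup E] [InnerProductSpace ℝ E]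
  [NormedAddCommGroup F] [InnerProductSpace ℝ F]

theorem norm_sq_sum_of_orthogonal [DecidableEq ι] {v : ι → F} {σ : ι → ℝ}
    (hv : ∀ i j, inner ℝ (v i) (v j) = if i = j then σ i ^ 2 else 0) (S : Finset ι) (c : ι → ℝ) :
    ‖∑ i ∈ S, c i • v i‖ ^ 2 = ∑ i ∈ S, c i ^ 2 * σ i ^ 2 := by
  rw [← real_inner_self_eq_norm_sq, sum_inner]
  refine Finset.sum_congr rfl fun i hi => ?_
  simp only [inner_sum, real_inner_smul_left, real_inner_smul_right, hv, mul_ite, mul_zero,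
    Finset.sum_ite_eq, hi, if_true]
  ring

theorem HilbertBasis.norm_sq_sum (b : HilbertBasis ι ℝ E) (S : Finset ι) (c : ι → ℝ) :
    ‖∑ i ∈ S, c i • b i‖ ^ 2 = ∑ i ∈ S, c i ^ 2 := by
  classical
  have h := norm_sq_sum_of_orthogonal (v := b) (σ := fun _ => 1) (fun i j => by
    rw [orthonormal_iff_ite.1 b.orthonormal i j]; simp) S c
  simpa using h

theorem approxNumber_le {T A : E →L[ℝ] F} {n : ℕ} {t : ℝ}
    (hA : A.toLinearMap.rank < (n : Cardinal)) (h : ‖T - A‖ ≤ t) : approxNumber T n ≤ t :=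
  (ciInf_le (f := fun A : {A : E →L[ℝ] F // A.toLinearMap.rank < (n : Cardinal)} => ‖T - A.1‖)
    ⟨0, by rintro _ ⟨B, rfl⟩; exact norm_nonneg _⟩ ⟨A, hA⟩).trans h

theorem le_approxNumber {T : E →L[ℝ] F} {n : ℕ} (hn : 1 ≤ n) {t : ℝ}
    (h : ∀ A : E →L[ℝ] F, A.toLinearMap.rank < (n : Cardinal) → t ≤ ‖T - A‖) :
    t ≤ approxNumber T n := by
  have : Nonempty {A : E →L[ℝ] F // A.toLinearMap.rank < (n : Cardinal)} :=
    ⟨⟨0, by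
      rw [ContinuousLinearMap.toLinearMap_zero, LinearMap.rank_zero]
      exact_mod_cast hn⟩⟩
  exact le_ciInf fun A => h A.1 A.2

/-- Truncating the basis expansion to `S` gives an operator of rank at most `S.card`. The error
involves only indices outside `S`, so orthogonality of the images and Bessel's inequality bound it
by `t`. -/
theorem approxNumber_le_of_orthogonal [DecidableEq ι] (b : HilbertBasis ι ℝ E) (T : E →L[ℝ] F)
    {σ : ι → ℝ} (hT : ∀ i j, inner ℝ (T (b i)) (T (b j)) = if i = j then σ i ^ 2 else 0)
    (hσ : ∀ i, 0 ≤ σ i) (S : Finset ι) {n : ℕ} (hS : S.card < n) {t : ℝ} (ht : 0 ≤ t)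
    (h : ∀ i ∉ S, σ i ≤ t) : approxNumber T n ≤ t := by
  let A : E →L[ℝ] F := ∑ i ∈ S, (innerSL ℝ (b i)).smulRight (T (b i))
  have hA : ∀ x, A x = ∑ i ∈ S, inner ℝ (b i) x • T (b i) := fun x => by
    simp [A]
  classical
  refine approxNumber_le (A := A) ?_ ?_
  · have hr : LinearMap.range A.toLinearMap ≤
        Submodule.span ℝ ((S.image fun i => T (b i) : Finset F) : Set F) := by
      rintro _ ⟨x, rfl⟩
      change A x ∈ _
      rw [hA]
      exact Submodule.sum_mem _ fun i hi => Submodule.smul_mem _ _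
        (Submodule.subset_span (by exact_mod_cast Finset.mem_image_of_mem _ hi))
    refine ((Submodule.rank_mono hr).trans (rank_span_finset_le _)).trans_lt ?_
    exact_mod_cast Finset.card_image_le.trans_lt hS
  · refine ContinuousLinearMap.opNorm_le_bound _ ht fun x => ?_
    -- The estimate is proved for finite partial sums of the expansion of `x` and passes to the
    -- limit by continuity.
    have hx := b.hasSum_repr x
    have hlim := ((T - A).continuous.tendsto x).comp hx
    refine le_of_tendsto hlim.norm (Filter.Eventually.of_forall fun U => ?_)
    have e : (T - A) (∑ i ∈ U, b.repr x i • b i) =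
        ∑ i ∈ U, (if i ∈ S then 0 else b.repr x i) • T (b i) := by
      rw [map_sum]
      refine Finset.sum_congr rfl fun i _ => ?_
      rw [map_smul, sub_apply, hA]
      have : ∑ j ∈ S, inner ℝ (b j) (b i) • T (b j) = if i ∈ S then T (b i) else 0 := by
        simp only [orthonormal_iff_ite.1 b.orthonormal, ite_smul, one_smul, zero_smul,
          Finset.sum_ite_eq']
      rw [this]
      split_ifs <;> simp
    refine le_of_sq_le_sq ?_ (by positivity)
    change ‖(T - A) (∑ i ∈ U, b.repr x i • b i)‖ ^ 2 ≤ _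
    rw [e, norm_sq_sum_of_orthogonal hT, mul_pow]
    have hB : ∑ i ∈ U, (b.repr x i) ^ 2 ≤ ‖x‖ ^ 2 := by
      have := b.orthonormal.sum_inner_products_le x (s := U)
      simpa [b.repr_apply_apply] using this
    refine le_trans ?_ (mul_le_mul_of_nonneg_left hB (by positivity))
    rw [Finset.mul_sum]
    refine Finset.sum_le_sum fun i _ => ?_
    split_ifs with hi
    · rw [zero_pow two_ne_zero, zero_mul]; positivity
    · rw [mul_comm]
      exact mul_le_mul_of_nonneg_right (pow_le_pow_left₀ (hσ i) (h i hi) 2) (sq_nonneg _)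

/-- An operator of rank less than `n` annihilates some nonzero vector in the span of the basis
vectors indexed by `S`. On that span `T` stretches every vector by at least `t`, and there `T - A`
agrees with `T`. -/
theorem le_approxNumber_of_orthogonal [DecidableEq ι] (b : HilbertBasis ι ℝ E) (T : E →L[ℝ] F)
    {σ : ι → ℝ} (hT : ∀ i j, inner ℝ (T (b i)) (T (b j)) = if i = j then σ i ^ 2 else 0)
    (S : Finset ι) {n : ℕ} (hn : 1 ≤ n) (hS : n ≤ S.card) {t : ℝ} (ht : 0 ≤ t)
    (h : ∀ i ∈ S, t ≤ σ i) : t ≤ approxNumber T n := by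
  refine le_approxNumber hn fun A hA => ?_
  have hdep : ¬ LinearIndependent ℝ fun i : S => A (b i) := by
    intro hli
    have hli' : LinearIndependent ℝ fun i : S =>
        (⟨A (b i), ⟨b i, rfl⟩⟩ : LinearMap.range A.toLinearMap) :=
      LinearIndependent.of_comp (LinearMap.range A.toLinearMap).subtype hli
    have h1 := hli'.cardinal_lift_le_rank
    have h2 : (n : Cardinal) ≤ A.toLinearMap.rank := by
      have h3 : Cardinal.lift.{0} ((S.card : ℕ) : Cardinal) ≤ A.toLinearMap.rank := by
        have h4 : Cardinal.lift.{max 0 _} (Cardinal.mk S) ≤ _ := h1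
        simpa using h4
      refine le_trans ?_ h3
      simpa using hS
    exact absurd hA (not_lt.2 h2)
  rw [Fintype.not_linearIndependent_iff] at hdep
  obtain ⟨g, hg, i₀, hi₀⟩ := hdep
  let c : ι → ℝ := fun i => if hi : i ∈ S then g ⟨i, hi⟩ else 0
  have hc : ∀ i : S, c i = g i := fun i => by simp [c]
  let x : E := ∑ i ∈ S, c i • b i
  have hAx : A x = 0 := by
    rw [← hg, map_sum, ← Finset.sum_coe_sort]
    exact Finset.sum_congr rfl fun i _ => by rw [map_smul, hc]
  have hxn : ‖x‖ ^ 2 = ∑ i ∈ S, c i ^ 2 := b.norm_sq_sum S c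
  have hTx : ‖T x‖ ^ 2 = ∑ i ∈ S, c i ^ 2 * σ i ^ 2 := by
    rw [← norm_sq_sum_of_orthogonal hT, map_sum]
    simp only [map_smul]
  have hx0 : 0 < ‖x‖ := by
    have : 0 < ‖x‖ ^ 2 := by
      rw [hxn]
      refine Finset.sum_pos' (fun i _ => sq_nonneg _) ⟨i₀, i₀.2, ?_⟩
      rw [hc]
      positivity
    exact (norm_nonneg x).lt_of_ne fun h0 => by simp [← h0] at this
  have hle : t * ‖x‖ ≤ ‖T x‖ := by
    refine le_of_sq_le_sq ?_ (norm_nonneg _)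
    rw [mul_pow, hxn, hTx, Finset.mul_sum]
    refine Finset.sum_le_sum fun i hi => ?_
    rw [mul_comm]
    exact mul_le_mul_of_nonneg_left (pow_le_pow_left₀ ht (h i hi) 2) (sq_nonneg _)
  have h5 := (T - A).le_opNorm x
  rw [sub_apply, hAx, sub_zero] at h5
  exact le_of_mul_le_mul_right (hle.trans h5) hx0

end DiagonalOperator

/-! ### Product bases of the tensor power -/

section TensorBasis

variable {X : Type*} [NormedAddCommGroup X] [InnerProductSpace ℝ X] {d : ℕ}

/-- Elementary tensors are total, so they separate points. This is how multilinearity is checked: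
formal combinations satisfy no tensor relations, which hold only in the Hausdorff completion. -/
theorem HilbertPower.ext_inner_elemTensor {x y : HilbertPower X d}
    (h : ∀ f, inner ℝ x (elemTensor f) = inner ℝ y (elemTensor f)) : x = y := by
  refine dense_span_elemTensor.eq_of_inner_left (𝕜 := ℝ) fun v hv => ?_
  induction hv using Submodule.span_induction with
  | mem z hz => obtain ⟨f, rfl⟩ := hz; exact h f
  | zero => simp
  | add u v _ _ hu hv => rw [inner_add_right, inner_add_right, hu, hv]
  | smul r u _ hu => rw [real_inner_smul_right, real_inner_smul_right, hu]

variable (X d) in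
/-- The elementary tensor, as a multilinear map. -/
def elemTensorMultilinear : MultilinearMap ℝ (fun _ : Fin d => X) (HilbertPower X d) where
  toFun := elemTensor
  map_update_add' {inst} m i x y := by
    -- The field is required for every decidability instance on `Fin d`; all of them equal the
    -- standard one.
    cases Subsingleton.elim inst (instDecidableEqFin d)
    refine HilbertPower.ext_inner_elemTensor fun f => ?_
    simp only [inner_add_left, inner_elemTensor]
    rw [← Finset.mul_prod_erase _ _ (Finset.mem_univ i),
      ← Finset.mul_prod_erase _ _ (Finset.mem_univ i),
      ← Finset.mul_prod_erase _ _ (Finset.mem_univ i)]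
    have e : ∀ z, ∏ j ∈ Finset.univ.erase i, inner ℝ (Function.update m i z j) (f j) =
        ∏ j ∈ Finset.univ.erase i, inner ℝ (m j) (f j) := fun z =>
      Finset.prod_congr rfl fun j hj => by rw [Function.update_of_ne (Finset.ne_of_mem_erase hj)]
    simp only [e, Function.update_self, inner_add_left, add_mul]
  map_update_smul' {inst} m i r x := by
    cases Subsingleton.elim inst (instDecidableEqFin d)
    refine HilbertPower.ext_inner_elemTensor fun f => ?_
    simp only [real_inner_smul_left, inner_elemTensor]
    rw [← Finset.mul_prod_erase _ _ (Finset.mem_univ i),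
      ← Finset.mul_prod_erase _ _ (Finset.mem_univ i)]
    have e : ∀ z, ∏ j ∈ Finset.univ.erase i, inner ℝ (Function.update m i z j) (f j) =
        ∏ j ∈ Finset.univ.erase i, inner ℝ (m j) (f j) := fun z =>
      Finset.prod_congr rfl fun j hj => by rw [Function.update_of_ne (Finset.ne_of_mem_erase hj)]
    simp only [e, Function.update_self, real_inner_smul_left, mul_assoc]

variable {ι : Type*}

theorem orthonormal_elemTensor (b : HilbertBasis ι ℝ X) (d : ℕ) :
    Orthonormal ℝ fun κ : Fin d → ι => elemTensor fun j => b (κ j) := by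
  classical
  rw [orthonormal_iff_ite]
  intro κ l
  simp only [inner_elemTensor, orthonormal_iff_ite.1 b.orthonormal]
  rw [Finset.prod_ite_zero]
  simp [funext_iff]

/-- By multilinearity, an elementary tensor of finite partial sums is a combination of product basis
vectors. Continuity of the elementary tensor then reaches all elementary tensors, which are total.
-/
theorem top_le_span_elemTensor (b : HilbertBasis ι ℝ X) (d : ℕ) :
    ⊤ ≤ (Submodule.span ℝ
      (Set.range fun κ : Fin d → ι => elemTensor fun j => b (κ j))).topologicalClosure := by
  classical
  set V := Submodule.span ℝ (Set.range fun κ : Fin d → ι => elemTensor fun j => b (κ j))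
  have h1 : ∀ f : Fin d → X, elemTensor f ∈ V.topologicalClosure := by
    intro f
    -- One finite set `s` truncates all coordinates simultaneously, so a single net suffices.
    have hlim : Filter.Tendsto (fun s : Finset ι => fun j => ∑ k ∈ s, b.repr (f j) k • b k)
        Filter.atTop (nhds f) := tendsto_pi_nhds.2 fun j => b.hasSum_repr (f j)
    refine mem_closure_of_tendsto ((continuous_elemTensor.tendsto f).comp hlim)
      (Filter.Eventually.of_forall fun s => ?_)
    have e := (elemTensorMultilinear X d).map_sum_finset
      (fun (j : Fin d) k => b.repr (f j) k • b k) (fun _ => s)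
    change elemTensorMultilinear X d (fun j => ∑ k ∈ s, b.repr (f j) k • b k) ∈ V
    rw [e]
    refine Submodule.sum_mem _ fun κ _ => ?_
    rw [MultilinearMap.map_smul_univ]
    exact Submodule.smul_mem _ _ (Submodule.subset_span ⟨κ, rfl⟩)
  have h2 : Submodule.span ℝ (Set.range (elemTensor (X := X) (d := d))) ≤ V.topologicalClosure :=
    Submodule.span_le.2 (by rintro _ ⟨f, rfl⟩; exact h1 f)
  intro x _
  exact closure_minimal h2 V.isClosed_topologicalClosure (dense_span_elemTensor x)

/-- The Hilbert basis of the tensor power formed by the elementary tensors of basis vectors. -/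
def HilbertBasis.tensorPower (b : HilbertBasis ι ℝ X) (d : ℕ) :
    HilbertBasis (Fin d → ι) ℝ (HilbertPower X d) :=
  HilbertBasis.mk (orthonormal_elemTensor b d) (top_le_span_elemTensor b d)

theorem HilbertBasis.tensorPower_apply (b : HilbertBasis ι ℝ X) (d : ℕ) (κ : Fin d → ι) :
    b.tensorPower d κ = elemTensor fun j => b (κ j) := by
  rw [HilbertBasis.tensorPower, HilbertBasis.coe_mk]

/-- Inner products of elementary tensors factor, so the tensor power of a diagonal operator is
diagonal, with products of the `σ i` on the diagonal. -/
theorem inner_tensorPowerMap_tensorPower [DecidableEq ι] {Ω : Type*} [MeasurableSpace Ω]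
    {μ : Measure Ω}
    [IsFiniteMeasure μ] (b : HilbertBasis ι ℝ X) (T : X →L[ℝ] Lp ℝ 2 μ) {σ : ι → ℝ}
    (hT : ∀ i j, inner ℝ (T (b i)) (T (b j)) = if i = j then σ i ^ 2 else 0) (κ l : Fin d → ι) :
    inner ℝ (tensorPowerMap T d (b.tensorPower d κ)) (tensorPowerMap T d (b.tensorPower d l)) =
      if κ = l then (∏ j, σ (κ j)) ^ 2 else 0 := by
  simp only [HilbertBasis.tensorPower_apply, tensorPowerMap_elemTensor, inner_prodLp, hT]
  rw [Finset.prod_ite_zero]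
  simp [funext_iff, Finset.prod_pow]

end TensorBasis

/-! ### Diagonalisation of the Jacobi embedding -/

namespace JacobiData

variable (J : JacobiData)

/-- The singular values `(1 + k / a)^(-s)` of the embedding of `K^s([-1, 1], w)`. -/
def singularValue (k : ℕ) : ℝ := (1 + J.a⁻¹ * k) ^ (-J.s)

theorem one_le_one_add (k : ℕ) : 1 ≤ 1 + J.a⁻¹ * k := by
  have := J.a_pos
  have : 0 ≤ J.a⁻¹ * k := by positivity
  linarith

theorem singularValue_pos (k : ℕ) : 0 < J.singularValue k :=
  Real.rpow_pos_of_pos (by linarith [J.one_le_one_add k]) _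

theorem fourierWeight_mul_singularValue_sq (k : ℕ) :
    J.fourierWeight k * J.singularValue k ^ 2 = 1 := by
  have h : 0 < 1 + J.a⁻¹ * (k : ℝ) := by linarith [J.one_le_one_add k]
  rw [fourierWeight, singularValue, ← Real.rpow_natCast, ← Real.rpow_mul h.le, ← Real.rpow_add h]
  rw [show 2 * J.s + -J.s * (2 : ℕ) = 0 by push_cast; ring, Real.rpow_zero]

theorem fourierCoef_jacobiLp (k l : ℕ) :
    J.fourierCoef k (J.jacobiLp l) = if k = l then 1 else 0 :=
  orthonormal_iff_ite.1 J.orthonormal_jacobiLp k l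

/-- The normalized Jacobi polynomials, rescaled to unit vectors of `K^s([-1, 1], w)`. -/
def unitK (k : ℕ) : J.K :=
  ⟨J.singularValue k • J.jacobiLp k, by
    refine summable_of_ne_finset_zero (s := {k}) fun l hl => ?_
    rw [map_smul, fourierCoef_jacobiLp, if_neg (by simpa using hl)]
    simp⟩

theorem incl_unitK (k : ℕ) : J.incl (J.unitK k) = J.singularValue k • J.jacobiLp k := rfl

/-- Only the `k`th term of the series survives. The scalar product with `unitK k` is thus a positive
multiple of the `k`th Fourier coefficient, which gives both orthonormality and totality of these
vectors. -/
theorem inner_unitK (k : ℕ) (f : J.K) :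
    inner ℝ (J.unitK k) f =
      J.fourierWeight k * J.singularValue k * J.fourierCoef k (J.incl f) := by
  rw [inner_K, tsum_eq_single k fun l hl => ?_]
  · rw [incl_unitK, map_smul, fourierCoef_jacobiLp, if_pos rfl]
    simp [mul_assoc]
  · rw [incl_unitK, map_smul, fourierCoef_jacobiLp, if_neg hl]
    simp

theorem orthonormal_unitK : Orthonormal ℝ J.unitK := by
  rw [orthonormal_iff_ite]
  intro k l
  rw [inner_unitK, incl_unitK, map_smul, fourierCoef_jacobiLp]
  split_ifs with h
  · subst h
    rw [smul_eq_mul, mul_one, mul_assoc, ← sq, fourierWeight_mul_singularValue_sq]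
  · simp

theorem eq_zero_of_inner_unitK {f : J.K} (h : ∀ k, inner ℝ (J.unitK k) f = 0) : f = 0 := by
  have h0 : ∀ k, J.fourierCoef k (J.incl f) = 0 := fun k => by
    have h1 := h k
    rw [inner_unitK] at h1
    have h2 : 0 < J.fourierWeight k * J.singularValue k :=
      mul_pos (by linarith [J.one_le_fourierWeight k]) (J.singularValue_pos k)
    exact (mul_eq_zero.1 h1).resolve_left h2.ne'
  refine (inner_self_eq_zero (𝕜 := ℝ)).1 ?_
  rw [inner_K]
  simp [h0]

/-- The Hilbert basis of `K^s([-1, 1], w)` of rescaled Jacobi polynomials. -/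
def basisK : HilbertBasis ℕ ℝ J.K :=
  HilbertBasis.mkOfOrthogonalEqBot J.orthonormal_unitK (by
    rw [eq_bot_iff]
    intro f hf
    refine J.eq_zero_of_inner_unitK fun k => ?_
    exact (Submodule.mem_orthogonal _ _).1 hf _ (Submodule.subset_span ⟨k, rfl⟩))

theorem inner_embedding_basisK (k l : ℕ) :
    inner ℝ (J.embedding (J.basisK k)) (J.embedding (J.basisK l)) =
      if k = l then J.singularValue k ^ 2 else 0 := by
  rw [basisK, HilbertBasis.coe_mkOfOrthogonalEqBot]
  change inner ℝ (J.incl (J.unitK k)) (J.incl (J.unitK l)) = _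
  rw [incl_unitK, incl_unitK, real_inner_smul_left, real_inner_smul_right,
    orthonormal_iff_ite.1 J.orthonormal_jacobiLp]
  split_ifs with h
  · rw [h]; ring
  · simp

theorem approxNumber_mixedEmbedding_le {d n : ℕ} (S : Finset (Fin d → ℕ)) (hS : S.card < n)
    {t : ℝ} (ht : 0 ≤ t) (h : ∀ κ ∉ S, ∏ j, J.singularValue (κ j) ≤ t) :
    approxNumber (J.mixedEmbedding d) n ≤ t :=
  approxNumber_le_of_orthogonal (J.basisK.tensorPower d) (J.mixedEmbedding d)
    (inner_tensorPowerMap_tensorPower J.basisK J.embedding J.inner_embedding_basisK)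
    (fun _ => Finset.prod_nonneg fun _ _ => (J.singularValue_pos _).le) S hS ht h

theorem le_approxNumber_mixedEmbedding {d n : ℕ} (S : Finset (Fin d → ℕ)) (hn : 1 ≤ n)
    (hS : n ≤ S.card) {t : ℝ} (ht : 0 ≤ t) (h : ∀ κ ∈ S, t ≤ ∏ j, J.singularValue (κ j)) :
    t ≤ approxNumber (J.mixedEmbedding d) n :=
  le_approxNumber_of_orthogonal (J.basisK.tensorPower d) (J.mixedEmbedding d)
    (inner_tensorPowerMap_tensorPower J.basisK J.embedding J.inner_embedding_basisK)
    S hn hS ht h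

end JacobiData

/-! ### Sums of powers and of products -/

/-- A telescoping form of the integral test:
$(x+1)^{-(1+\delta)}\le(x^{-\delta}-(x+1)^{-\delta})/\delta$. -/
theorem sum_add_one_rpow_neg_le {δ : ℝ} (hδ : 0 < δ) (N : ℕ) :
    ∑ k ∈ Finset.range N, ((k : ℝ) + 1) ^ (-(1 + δ)) ≤ 1 + 1 / δ := by
  have key : ∀ N : ℕ, ∑ k ∈ Finset.range (N + 1), ((k : ℝ) + 1) ^ (-(1 + δ)) ≤
      1 + (1 - ((N : ℝ) + 1) ^ (-δ)) / δ := by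
    intro N
    induction N with
    | zero => simp
    | succ N ih =>
      rw [Finset.sum_range_succ]
      push_cast
      have hx : (0 : ℝ) < (N : ℝ) + 1 := by positivity
      have hy : (0 : ℝ) < (N : ℝ) + 1 + 1 := by positivity
      set x : ℝ := (N : ℝ) + 1 with hxd
      have h1 : (x + 1) ^ (-(1 + δ)) = (x + 1) ^ (-δ) * (x + 1)⁻¹ := by
        rw [← Real.rpow_neg_one, ← Real.rpow_add hy]
        congr 1
        ring
      have h2 : x ^ (-δ) = (x + 1) ^ (-δ) * ((x + 1) / x) ^ δ := by
        rw [Real.div_rpow hy.le hx.le, Real.rpow_neg hy.le, Real.rpow_neg hx.le]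
        have := (Real.rpow_pos_of_pos hy δ).ne'
        field_simp
      -- With $y=(x+1)/x$, this combines $1-1/y\le\log y$ and $1+u\le e^u$ at $u=\delta\log y$.
      have h3 : 1 + δ * (x + 1)⁻¹ ≤ ((x + 1) / x) ^ δ := by
        have h4 : 0 < (x + 1) / x := by positivity
        rw [Real.rpow_def_of_pos h4]
        have h5 := Real.one_sub_inv_le_log_of_pos h4
        have h6 : 1 - ((x + 1) / x)⁻¹ = (x + 1)⁻¹ := by field_simp; ring
        rw [h6] at h5
        have h7 := Real.add_one_le_exp (Real.log ((x + 1) / x) * δ)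
        nlinarith
      have h8 : (x + 1) ^ (-δ) * (1 + δ * (x + 1)⁻¹) ≤ x ^ (-δ) := by
        rw [h2]
        exact mul_le_mul_of_nonneg_left h3 (Real.rpow_nonneg hy.le _)
      have h9 : (x + 1) ^ (-(1 + δ)) ≤ (x ^ (-δ) - (x + 1) ^ (-δ)) / δ := by
        rw [h1, le_div_iff₀ hδ]
        nlinarith
      have h10 : 1 + (1 - (x + 1) ^ (-δ)) / δ =
          1 + (1 - x ^ (-δ)) / δ + (x ^ (-δ) - (x + 1) ^ (-δ)) / δ := by ring
      rw [h10]
      exact add_le_add ih h9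
  have h0 : ∑ k ∈ Finset.range N, ((k : ℝ) + 1) ^ (-(1 + δ)) ≤
      ∑ k ∈ Finset.range (N + 1), ((k : ℝ) + 1) ^ (-(1 + δ)) := by
    rw [Finset.sum_range_succ]
    exact le_add_of_nonneg_right (by positivity)
  refine (h0.trans (key N)).trans ?_
  have : (0 : ℝ) ≤ ((N : ℝ) + 1) ^ (-δ) := by positivity
  gcongr
  linarith

/-- A finite set of multi-indices lies in a cube, over which the sum of products factors into a
`d`th power. -/
theorem sum_prod_le_pow {d : ℕ} {g : ℕ → ℝ} (hg : ∀ k, 0 ≤ g k) {M : ℝ}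
    (hM : ∀ N, ∑ k ∈ Finset.range N, g k ≤ M) (S : Finset (Fin d → ℕ)) :
    ∑ κ ∈ S, ∏ j, g (κ j) ≤ M ^ d := by
  classical
  obtain ⟨N, hN⟩ : ∃ N, S ⊆ Fintype.piFinset fun _ : Fin d => Finset.range N := by
    refine ⟨(S.sup fun κ => Finset.univ.sup κ) + 1, fun κ hκ => ?_⟩
    rw [Fintype.mem_piFinset]
    intro j
    rw [Finset.mem_range, Nat.lt_succ_iff]
    exact (Finset.le_sup (f := κ) (Finset.mem_univ j)).trans
      (Finset.le_sup (f := fun κ : Fin d → ℕ => Finset.univ.sup κ) hκ)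
  calc ∑ κ ∈ S, ∏ j, g (κ j)
      ≤ ∑ κ ∈ Fintype.piFinset fun _ : Fin d => Finset.range N, ∏ j, g (κ j) :=
        Finset.sum_le_sum_of_subset_of_nonneg hN fun _ _ _ => Finset.prod_nonneg fun _ _ => hg _
    _ = (∑ k ∈ Finset.range N, g k) ^ d := by
        rw [Finset.sum_prod_piFinset (Finset.range N) fun _ k => g k]
        simp
    _ ≤ M ^ d := pow_le_pow_left₀ (Finset.sum_nonneg fun _ _ => hg _) (hM N) d

/-! ### Counting small subsets -/

/-- Factor by factor, $(l-j)/l\le(d-j)/d$ compares the two falling factorials; cancelling $i!$ gives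
the binomials. -/
theorem choose_mul_pow_le {d l : ℕ} (h : l ≤ d) (i : ℕ) :
    l.choose i * d ^ i ≤ d.choose i * l ^ i := by
  have key : l.descFactorial i * d ^ i ≤ d.descFactorial i * l ^ i := by
    induction i with
    | zero => simp
    | succ i ih =>
      rw [Nat.descFactorial_succ, Nat.descFactorial_succ, pow_succ, pow_succ]
      have h1 : (l - i) * d ≤ (d - i) * l := by
        rw [Nat.sub_mul, Nat.sub_mul, mul_comm d l]
        exact Nat.sub_le_sub_left (Nat.mul_le_mul_left i h) _
      calc (l - i) * l.descFactorial i * (d ^ i * d)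
          = ((l - i) * d) * (l.descFactorial i * d ^ i) := by ring
        _ ≤ ((d - i) * l) * (d.descFactorial i * l ^ i) := Nat.mul_le_mul h1 ih
        _ = _ := by ring
  rw [Nat.descFactorial_eq_factorial_mul_choose, Nat.descFactorial_eq_factorial_mul_choose,
    mul_assoc, mul_assoc] at key
  exact Nat.le_of_mul_le_mul_left key i.factorial_pos

/-- Expand by the binomial theorem and compare term by term: $\binom li(d/l)^i\le\binom di$. -/
theorem one_add_div_pow_le_sum_choose {d l : ℕ} (hl : 1 ≤ l) (h : l ≤ d) :
    (1 + (d : ℝ) / l) ^ l ≤ ((∑ i ∈ Finset.range (l + 1), d.choose i : ℕ) : ℝ) := by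
  have hl0 : (0 : ℝ) < l := by exact_mod_cast hl
  rw [add_comm, add_pow]
  push_cast
  refine Finset.sum_le_sum fun i _ => ?_
  have := choose_mul_pow_le h i
  have h2 : (l.choose i : ℝ) * (d : ℝ) ^ i ≤ d.choose i * (l : ℝ) ^ i := by exact_mod_cast this
  rw [one_pow, mul_one, div_pow, div_mul_eq_mul_div, div_le_iff₀ (by positivity)]
  linarith

/-- The indicator functions, with values in `ℕ`, of the sets of at most `m` points. -/
def smallIndicators (d m : ℕ) : Finset (Fin d → ℕ) :=
  ((Finset.range (m + 1)).biUnion fun i => Finset.powersetCard i (Finset.univ : Finset (Fin d))).map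
    ⟨fun u j => if j ∈ u then 1 else 0, fun u v h => by
      ext j
      have := congrFun h j
      by_cases hu : j ∈ u <;> by_cases hv : j ∈ v <;> simp_all⟩

theorem card_smallIndicators (d m : ℕ) :
    (smallIndicators d m).card = ∑ i ∈ Finset.range (m + 1), d.choose i := by
  rw [smallIndicators, Finset.card_map, Finset.card_biUnion]
  · simp
  · exact fun i _ j _ hij => Finset.pairwise_disjoint_powersetCard _ hij

theorem exists_of_mem_smallIndicators {d m : ℕ} {κ : Fin d → ℕ} (h : κ ∈ smallIndicators d m) :
    ∃ u : Finset (Fin d), u.card ≤ m ∧ κ = fun j => if j ∈ u then 1 else 0 := by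
  rw [smallIndicators, Finset.mem_map] at h
  obtain ⟨u, hu, rfl⟩ := h
  simp only [Finset.mem_biUnion, Finset.mem_range, Finset.mem_powersetCard] at hu
  obtain ⟨i, hi, -, rfl⟩ := hu
  exact ⟨u, by omega, rfl⟩

/-- If fewer than `n` subsets of `d` points have at most `l` elements, then
`l ≤ log n / log (1 + d / log₂ n)`. -/
theorem mul_log_le_log_of_sum_choose_lt {d l n : ℕ} (hn : 2 ≤ n) (h : l ≤ d)
    (hl : ∑ i ∈ Finset.range (l + 1), d.choose i < n) :
    l * Real.log (1 + (d : ℝ) / Real.logb 2 n) ≤ Real.log n := by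
  have hn1 : (1 : ℝ) < n := by exact_mod_cast hn
  rcases Nat.eq_zero_or_pos l with rfl | hl1
  · simpa using Real.log_nonneg hn1.le
  have hl0 : (0 : ℝ) < l := by exact_mod_cast hl1
  have hld : (l : ℝ) ≤ d := by exact_mod_cast h
  have h1 : (1 + (d : ℝ) / l) ^ l ≤ n :=
    (one_add_div_pow_le_sum_choose hl1 h).trans (by exact_mod_cast hl.le)
  -- Since $d/l\ge1$, the base is at least 2. This yields $l\le\log_2 n$, so that $l$ may be
  -- replaced by $\log_2 n$ in the denominator.
  have h2 : (2 : ℝ) ^ l ≤ n := by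
    refine le_trans (pow_le_pow_left₀ (by norm_num) ?_ l) h1
    have : 1 ≤ (d : ℝ) / l := by rwa [one_le_div hl0]
    linarith
  have h3 : (l : ℝ) ≤ Real.logb 2 n := by
    rw [Real.le_logb_iff_rpow_le (by norm_num) (by linarith), Real.rpow_natCast]
    exact h2
  have h5 : 1 + (d : ℝ) / Real.logb 2 n ≤ 1 + (d : ℝ) / l := by gcongr
  have h6 : 0 < 1 + (d : ℝ) / Real.logb 2 n := by
    have : 0 < Real.logb 2 n := hl0.trans_le h3
    positivity
  calc l * Real.log (1 + (d : ℝ) / Real.logb 2 n) ≤ l * Real.log (1 + (d : ℝ) / l) := by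
        gcongr
    _ = Real.log ((1 + (d : ℝ) / l) ^ l) := (Real.log_pow _ _).symm
    _ ≤ Real.log n := Real.log_le_log (by positivity) h1

/-! ### The two bounds -/

namespace JacobiData

variable (J : JacobiData)

theorem log_ratio_pos : 0 < Real.log ((J.a + 1) / J.a) :=
  Real.log_pos (by rw [one_lt_div J.a_pos]; linarith)

theorem one_add_inv_a : 1 + J.a⁻¹ = (J.a + 1) / J.a := by
  have := J.a_pos.ne'
  field_simp

theorem singularValue_zero : J.singularValue 0 = 1 := by simp [singularValue]

theorem singularValue_one : J.singularValue 1 = (J.a / (J.a + 1)) ^ J.s := by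
  have := J.a_pos
  rw [singularValue, Nat.cast_one, mul_one, one_add_inv_a, Real.rpow_neg (by positivity),
    ← Real.inv_rpow (by positivity), inv_div]

theorem singularValue_one_eq_exp :
    J.singularValue 1 = Real.exp (-(J.s * Real.log ((J.a + 1) / J.a))) := by
  have := J.a_pos
  rw [singularValue, Nat.cast_one, mul_one, one_add_inv_a, Real.rpow_def_of_pos (by positivity)]
  congr 1
  ring

theorem prod_singularValue_indicator {d : ℕ} (u : Finset (Fin d)) :
    ∏ j, J.singularValue (if j ∈ u then 1 else 0) = J.singularValue 1 ^ u.card := by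
  have : ∀ j, J.singularValue (if j ∈ u then 1 else 0) =
      if j ∈ u then J.singularValue 1 else 1 := fun j => by
    split_ifs <;> simp [singularValue_zero]
  simp only [this, Finset.prod_ite_mem, Finset.univ_inter, Finset.prod_const]

theorem approxNumber_lower_bound {d n : ℕ} (hn : 2 ≤ n) (hnd : n ≤ 2 ^ d) :
    (J.a / (J.a + 1)) ^ J.s * (1 / (n : ℝ)) ^ (J.s * Real.log ((J.a + 1) / J.a) /
        Real.log (1 + (d : ℝ) / Real.logb 2 (n : ℝ))) ≤
      approxNumber (J.mixedEmbedding d) n := by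
  have hL := J.log_ratio_pos
  have hs := J.s_pos
  have hn1 : (1 : ℝ) < n := by exact_mod_cast hn
  have hex : ∃ m, n ≤ ∑ i ∈ Finset.range (m + 1), d.choose i :=
    ⟨d, by rwa [Nat.sum_range_choose]⟩
  classical
  set m := Nat.find hex with hm
  have hm1 : n ≤ ∑ i ∈ Finset.range (m + 1), d.choose i := Nat.find_spec hex
  have hmd : m ≤ d := Nat.find_min' hex (by rwa [Nat.sum_range_choose])
  -- For $m=0$ the count is 1, which is below $n\ge2$.
  obtain ⟨l, hl⟩ : ∃ l, m = l + 1 := by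
    refine Nat.exists_eq_succ_of_ne_zero fun h0 => ?_
    rw [h0] at hm1
    simp at hm1
    omega
  have hlt : ∑ i ∈ Finset.range (l + 1), d.choose i < n :=
    not_le.1 (Nat.find_min hex (show l < Nat.find hex by omega))
  have hlog := mul_log_le_log_of_sum_choose_lt hn (by omega) hlt
  have hd0 : (0 : ℝ) < d := by
    have : 0 < d := by omega
    exact_mod_cast this
  have hx : 0 < Real.logb 2 (n : ℝ) := Real.logb_pos (by norm_num) hn1
  have hD : 0 < Real.log (1 + (d : ℝ) / Real.logb 2 (n : ℝ)) := by
    refine Real.log_pos ?_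
    have : 0 < (d : ℝ) / Real.logb 2 (n : ℝ) := by positivity
    linarith
  have hv1 : J.singularValue 1 ≤ 1 := by
    rw [singularValue_one_eq_exp, Real.exp_le_one_iff]
    have := mul_pos hs hL
    linarith
  have hmain : J.singularValue 1 ^ m ≤ approxNumber (J.mixedEmbedding d) n := by
    refine J.le_approxNumber_mixedEmbedding (smallIndicators d m) (by omega)
      (by rwa [card_smallIndicators]) (pow_nonneg (J.singularValue_pos 1).le _) fun κ hκ => ?_
    obtain ⟨u, hu, rfl⟩ := exists_of_mem_smallIndicators hκ
    rw [prod_singularValue_indicator]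
    exact pow_le_pow_of_le_one (J.singularValue_pos 1).le hv1 hu
  refine le_trans ?_ hmain
  -- One of the $l+1$ factors is the constant $(a/(a+1))^s$; the remaining $l$ are controlled by
  -- `hlog`.
  rw [hl, pow_succ', ← singularValue_one]
  refine mul_le_mul_of_nonneg_left ?_ (J.singularValue_pos 1).le
  rw [singularValue_one_eq_exp, ← Real.exp_nat_mul, Real.rpow_def_of_pos (by positivity),
    Real.exp_le_exp, one_div, Real.log_inv]
  have h1 : (l : ℝ) * (J.s * Real.log ((J.a + 1) / J.a)) ≤
      Real.log n * (J.s * Real.log ((J.a + 1) / J.a) /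
        Real.log (1 + (d : ℝ) / Real.logb 2 (n : ℝ))) := by
    rw [mul_div_assoc', le_div_iff₀ hD]
    have := mul_le_mul_of_nonneg_right hlog (mul_pos hs hL).le
    linarith
  linarith

/-- The exponent is $s/q=\log d/L+(1+\delta)$. Its first part gains a factor $1/d$ in every term
with $k\ge1$, and its second part makes the series converge. -/
theorem sum_rpow_neg_le {δ : ℝ} (hδ : δ ∈ Set.Ioc (0 : ℝ) 1) {d : ℕ} (hd : 1 ≤ d) (N : ℕ) :
    ∑ k ∈ Finset.range N, (1 + J.a⁻¹ * k) ^
        (-((Real.log d + (1 + δ) * Real.log ((J.a + 1) / J.a)) / Real.log ((J.a + 1) / J.a))) ≤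
      1 + (2 * J.a) ^ (1 + δ) / δ / d := by
  obtain ⟨hδ0, hδ1⟩ := hδ
  have ha := J.a_pos
  have hL := J.log_ratio_pos
  have hd0 : (0 : ℝ) < d := by exact_mod_cast hd
  have hlogd : 0 ≤ Real.log d := Real.log_nonneg (by exact_mod_cast hd)
  set L := Real.log ((J.a + 1) / J.a) with hLdef
  have hρ : (Real.log d + (1 + δ) * L) / L = Real.log d / L + (1 + δ) := by
    field_simp
  rw [hρ]
  have hterm : ∀ k : ℕ, (1 + J.a⁻¹ * ((k + 1 : ℕ) : ℝ)) ^ (-(Real.log d / L + (1 + δ))) ≤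
      (d : ℝ)⁻¹ * (J.a ^ (1 + δ) * ((k : ℝ) + 1) ^ (-(1 + δ))) := by
    intro k
    have hk : (0 : ℝ) < (k : ℝ) + 1 := by positivity
    push_cast
    have hpos : 0 < 1 + J.a⁻¹ * ((k : ℝ) + 1) := by positivity
    rw [neg_add, Real.rpow_add hpos]
    refine mul_le_mul ?_ ?_ (by positivity) (by positivity)
    -- The worst case is $k=0$ after the index shift, where the base is $(a+1)/a=e^L$ and the power
    -- is exactly $1/d$.
    · have h1 : (1 + J.a⁻¹ * ((k : ℝ) + 1)) ^ (-(Real.log d / L)) ≤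
          ((J.a + 1) / J.a) ^ (-(Real.log d / L)) := by
        refine Real.rpow_le_rpow_of_nonpos (by positivity) ?_ (neg_nonpos.2 (by positivity))
        rw [← one_add_inv_a]
        have : 0 ≤ J.a⁻¹ * (k : ℝ) := by positivity
        linarith
      refine h1.trans_eq ?_
      rw [Real.rpow_def_of_pos (by positivity), ← hLdef, mul_neg, mul_div_cancel₀ _ hL.ne',
        Real.exp_neg, Real.exp_log hd0]
    · have h1 : (1 + J.a⁻¹ * ((k : ℝ) + 1)) ^ (-(1 + δ)) ≤
          (J.a⁻¹ * ((k : ℝ) + 1)) ^ (-(1 + δ)) :=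
        Real.rpow_le_rpow_of_nonpos (by positivity) (by linarith) (by linarith)
      refine h1.trans_eq ?_
      rw [Real.mul_rpow (by positivity) hk.le, Real.inv_rpow ha.le, Real.rpow_neg ha.le, inv_inv]
  have hS : J.a ^ (1 + δ) * (1 + 1 / δ) ≤ (2 * J.a) ^ (1 + δ) / δ := by
    rw [Real.mul_rpow (by norm_num) ha.le]
    -- Here $\delta\le1$ enters, through $1+\delta\le2\le2^{1+\delta}$; this produces the 2 in
    -- $(2a)^{1+\delta}$.
    have h2 : 1 + δ ≤ (2 : ℝ) ^ (1 + δ) := by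
      have := Real.rpow_le_rpow_of_exponent_le (x := 2) (by norm_num) (by linarith : 1 ≤ 1 + δ)
      rw [Real.rpow_one] at this
      linarith
    have h3 : 1 + 1 / δ = (1 + δ) / δ := by field_simp; ring
    rw [h3, ← mul_div_assoc]
    refine div_le_div_of_nonneg_right ?_ hδ0.le
    rw [mul_comm]
    exact mul_le_mul_of_nonneg_right h2 (by positivity)
  rcases N with _ | N
  · simp only [Finset.range_zero, Finset.sum_empty]
    positivity
  -- The term $k=0$ equals 1 and is split off, since it gains no factor $1/d$.
  rw [Finset.sum_range_succ', add_comm]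
  refine add_le_add (by simp) ?_
  refine (Finset.sum_le_sum fun k _ => hterm k).trans ?_
  rw [← Finset.mul_sum, ← Finset.mul_sum, div_eq_inv_mul]
  refine mul_le_mul_of_nonneg_left (le_trans ?_ hS) (by positivity)
  exact mul_le_mul_of_nonneg_left (sum_add_one_rpow_neg_le hδ0 N) (by positivity)

theorem sum_prod_singularValue_rpow_le {δ : ℝ} (hδ : δ ∈ Set.Ioc (0 : ℝ) 1) {d : ℕ} (hd : 1 ≤ d)
    (S : Finset (Fin d → ℕ)) :
    ∑ κ ∈ S, (∏ j, J.singularValue (κ j)) ^ (J.s * Real.log ((J.a + 1) / J.a) /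
        (Real.log (d : ℝ) + (1 + δ) * Real.log ((J.a + 1) / J.a)))⁻¹ ≤
      Real.exp ((2 * J.a) ^ (1 + δ) / δ) := by
  have hd0 : (0 : ℝ) < d := by exact_mod_cast hd
  have ha := J.a_pos
  have hL := J.log_ratio_pos
  have hs := J.s_pos
  have hpos : ∀ k : ℕ, 0 < 1 + J.a⁻¹ * (k : ℝ) := fun k => by linarith [J.one_le_one_add k]
  have hterm : ∀ κ : Fin d → ℕ, (∏ j, J.singularValue (κ j)) ^
      (J.s * Real.log ((J.a + 1) / J.a) /
        (Real.log (d : ℝ) + (1 + δ) * Real.log ((J.a + 1) / J.a)))⁻¹ =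
      ∏ j, (1 + J.a⁻¹ * (κ j : ℝ)) ^ (-((Real.log d + (1 + δ) * Real.log ((J.a + 1) / J.a)) /
        Real.log ((J.a + 1) / J.a))) := fun κ => by
    rw [← Real.finsetProd_rpow _ _ fun j _ => (J.singularValue_pos _).le]
    refine Finset.prod_congr rfl fun j _ => ?_
    rw [singularValue, ← Real.rpow_mul (hpos _).le]
    congr 1
    rw [inv_div]
    field_simp
  simp only [hterm]
  refine (sum_prod_le_pow (fun k => Real.rpow_nonneg (hpos k).le _)
    (J.sum_rpow_neg_le hδ hd) S).trans ?_
  have h1 : 1 + (2 * J.a) ^ (1 + δ) / δ / d ≤ Real.exp ((2 * J.a) ^ (1 + δ) / δ / d) := by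
    rw [add_comm]
    exact Real.add_one_le_exp _
  have hδ0 := hδ.1
  refine (pow_le_pow_left₀ (by positivity) h1 d).trans_eq ?_
  rw [← Real.exp_nat_mul, mul_div_cancel₀ _ hd0.ne']

/-- Markov's inequality: the $1/q$-th powers of the products sum to at most $C$, while each product
above $t=(C/n)^q$ contributes more than $C/n$. So fewer than $n$ products exceed $t$. -/
theorem approxNumber_upper_bound {δ : ℝ} (hδ : δ ∈ Set.Ioc (0 : ℝ) 1) {d : ℕ} (hd : 1 ≤ d)
    {n : ℕ} (hn : 1 ≤ n) :
    approxNumber (J.mixedEmbedding d) n ≤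
      (Real.exp ((2 * J.a) ^ (1 + δ) / δ) / (n : ℝ)) ^
        (J.s * Real.log ((J.a + 1) / J.a) /
          (Real.log (d : ℝ) + (1 + δ) * Real.log ((J.a + 1) / J.a))) := by
  have hL := J.log_ratio_pos
  have hs := J.s_pos
  have hn0 : (0 : ℝ) < n := by exact_mod_cast hn
  have hlogd : 0 ≤ Real.log d := Real.log_nonneg (by exact_mod_cast hd)
  have hsum := J.sum_prod_singularValue_rpow_le hδ hd
  have hδ0 := hδ.1
  have hq : 0 < J.s * Real.log ((J.a + 1) / J.a) /
      (Real.log (d : ℝ) + (1 + δ) * Real.log ((J.a + 1) / J.a)) := by positivity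
  set q := J.s * Real.log ((J.a + 1) / J.a) /
    (Real.log (d : ℝ) + (1 + δ) * Real.log ((J.a + 1) / J.a))
  set C := Real.exp ((2 * J.a) ^ (1 + δ) / δ)
  have hC : 0 < C := Real.exp_pos _
  set t := (C / n) ^ q with ht
  have ht0 : 0 < t := by positivity
  have htq : t ^ q⁻¹ = C / n := Real.rpow_rpow_inv (by positivity) hq.ne'
  have hcard : ∀ G : Finset (Fin d → ℕ), (∀ κ ∈ G, t < ∏ j, J.singularValue (κ j)) →
      G.card < n := by
    intro G hG
    rcases G.eq_empty_or_nonempty with rfl | hne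
    · rw [Finset.card_empty]; omega
    have h1 : ∑ _κ ∈ G, C / n < ∑ κ ∈ G, (∏ j, J.singularValue (κ j)) ^ q⁻¹ :=
      Finset.sum_lt_sum_of_nonempty hne fun κ hκ => by
        rw [← htq]
        exact Real.rpow_lt_rpow ht0.le (hG κ hκ) (inv_pos.2 hq)
    have h2 := h1.trans_le (hsum G)
    rw [Finset.sum_const, nsmul_eq_mul, mul_div_assoc', div_lt_iff₀ hn0, mul_comm] at h2
    exact_mod_cast lt_of_mul_lt_mul_left h2 hC.le
  -- An infinite set would contain a subset of exactly `n` elements, contradicting the strict bound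
  -- `hcard`.
  have hfin : {κ : Fin d → ℕ | t < ∏ j, J.singularValue (κ j)}.Finite := by
    by_contra hinf
    obtain ⟨G, hG, hGn⟩ := Set.Infinite.exists_subset_card_eq hinf n
    exact (hcard G fun κ hκ => hG hκ).ne hGn
  refine J.approxNumber_mixedEmbedding_le hfin.toFinset (hcard _ fun κ hκ => by simpa using hκ)
    ht0.le fun κ hκ => ?_
  simpa using hκ

end JacobiData

end

theorem mainTheorem12 (J : JacobiData) (δ : ℝ) (hδ : δ ∈ Set.Ioc (0 : ℝ) 1)
    (d : ℕ) (hd : 1 ≤ d) :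
    (∀ n : ℕ, 2 ≤ n → n ≤ 2 ^ d →
      (J.a / (J.a + 1)) ^ J.s *
          (1 / (n : ℝ)) ^ (J.s * Real.log ((J.a + 1) / J.a) /
            Real.log (1 + (d : ℝ) / Real.logb 2 (n : ℝ))) ≤
        approxNumber (J.mixedEmbedding d) n) ∧
    (∀ n : ℕ, 1 ≤ n →
      approxNumber (J.mixedEmbedding d) n ≤
        (Real.exp ((2 * J.a) ^ (1 + δ) / δ) / (n : ℝ)) ^
          (J.s * Real.log ((J.a + 1) / J.a) /
            (Real.log (d : ℝ) + (1 + δ) * Real.log ((J.a + 1) / J.a)))) := by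
  exact ⟨fun n hn hnd => J.approxNumber_lower_bound hn hnd,
    fun n hn => J.approxNumber_upper_bound hδ hd hn⟩
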